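/- Let $(\Omega,\mathcal F,\mathbb P)$ be a probability space and let $\Lambda=(\Lambda(A))$, indexed by the bounded Borel sets $A\subseteq\mathbb R_+\times\mathbb R$ (where $\mathbb R_+=[0,\infty)$), be a (not necessarily homogeneous) Lévy basis, that is, an infinitely divisible independently scattered random measure: each $\Lambda(A)$ is a real random variable with infinitely divisible law; $\Lambda(A_1),\Lambda(A_2),\dots$ are independent whenever $A_1,A_2,\dots$ are pairwise disjoint; and if moreover $\bigcup_n A_n$ is bounded, then $\Lambda(\bigcup_n A_n)=\sum_n\Lambda(A_n)$ almost surely, the series converging almost surely. Assume that $\Lambda$ has mean $0$, i.e. $\mathbb E|\Lambda(A)|<\infty$ and $\mathbb E[\Lambda(A)]=0$ for every bounded Borel set $A$. Let $c>0$. Write $(s,y)\preceq(t,x)$ if $s\le t$ and $|x-y|\le c(t-s)$, let $[(\tilde t,\tilde x),(t,x)]_\preceq$ be the set of all $(s,y)\in\mathbb R_+\times\mathbb R$ with $(\tilde t,\tilde x)\preceq(s,y)\preceq(t,x)$, and let $A^+(t,x)=\{(s,y)\in\mathbb R_+\times\mathbb R: s\le t,\ |x-y|\le c(t-s)\}$ be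 the backward light cone of $(t,x)$. Fix $(\tilde t,\tilde x)\preceq(t,x)$ in $\mathbb R_+\times\mathbb R$ and put $I=[(\tilde t,\tilde x),(t,x)]_\preceq$. The process $(s,y)\mapsto\Lambda(A^+(s,y))$ on $\mathbb R_+\times\mathbb R$ has a version $X$ that is separable on $I$ in the sense of Doob: there is a countable $D\subseteq I$ such that almost surely, for every $r\in I$ and every neighbourhood $U$ of $r$, the value $X(r)$ lies in the closure of $\{X(u):u\in D\cap U\}$. For every such version $X$ the supremum of $|X|$ over $I$ is (almost surely equal to) a random variable with values in $[0,\infty]$, and the following hold. 1. For every $\lambda>0$, $$\lambda\,\mathbb P\Big[\sup_{(s,y)\in I}|X(s,y)|\ge\lambda\Big]\le 13\,\mathbb E\big[|X(t,x)|\big].$$ 2. If $p>1$ and $\Lambda$ has a finite $p$-th moment, i.e. $\mathbb E|\Lambda(A)|^p<\infty$ for every bounded Borel set $A$, then $$\mathbb E\Big[\sup_{(s,y)\in I}|X(s,y)|^p\Big]\le\Big(\frac p{p-1}\Big)^{2p}\,\mathbb E\big[|X(t,x)|^p\big].$$ -/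

import Mathlib

open MeasureTheory ProbabilityTheory Filter Topology
open scoped NNReal ENNReal

/-- A law on `ℝ` is infinitely divisible if for every `n ≥ 1` it is the law of a sum of `n`
i.i.d. random variables, i.e. an `n`-fold convolution power of a probability measure. -/
def IsInfinitelyDivisible (m : Measure ℝ) : Prop :=
  ∀ n : ℕ, 1 ≤ n → ∃ ρ : Measure ℝ, IsProbabilityMeasure ρ ∧
    (Measure.pi (fun _ : Fin n => ρ)).map (fun x => ∑ i, x i) = m

/-- A (not necessarily homogeneous) Lévy basis on `ℝ₊ × ℝ`: an infinitely divisible independently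
scattered random measure. Only the values `Λ A` at bounded Borel sets `A` are meaningful.
The series in `sigma_additive` is only required to converge almost surely in the given order:
absolute convergence fails already for Gaussian white noise. -/
structure IsLevyBasis {Ω : Type*} [MeasurableSpace Ω]
    (Λ : Set (ℝ≥0 × ℝ) → Ω → ℝ) (P : Measure Ω) : Prop where
  measurable : ∀ A : Set (ℝ≥0 × ℝ), MeasurableSet A → Bornology.IsBounded A → Measurable (Λ A)
  indep : ∀ A : ℕ → Set (ℝ≥0 × ℝ), (∀ n, MeasurableSet (A n)) →
    (∀ n, Bornology.IsBounded (A n)) → Pairwise (Function.onFun Disjoint A) →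
    iIndepFun (fun n => Λ (A n)) P
  sigma_additive : ∀ A : ℕ → Set (ℝ≥0 × ℝ), (∀ n, MeasurableSet (A n)) →
    Bornology.IsBounded (⋃ n, A n) → Pairwise (Function.onFun Disjoint A) →
    ∀ᵐ ω ∂P, Tendsto (fun N : ℕ => ∑ n ∈ Finset.range N, Λ (A n) ω) atTop
      (𝓝 (Λ (⋃ n, A n) ω))
  infinitely_divisible : ∀ A : Set (ℝ≥0 × ℝ), MeasurableSet A → Bornology.IsBounded A →
    IsInfinitelyDivisible (P.map (Λ A))

/-- The random measure `Λ` has mean `0`. -/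
def HasMeanZero {Ω : Type*} [MeasurableSpace Ω]
    (Λ : Set (ℝ≥0 × ℝ) → Ω → ℝ) (P : Measure Ω) : Prop :=
  ∀ A : Set (ℝ≥0 × ℝ), MeasurableSet A → Bornology.IsBounded A →
    Integrable (Λ A) P ∧ ∫ ω, Λ A ω ∂P = 0

/-- The random measure `Λ` has a finite moment of order `a`. -/
def HasFiniteMoment {Ω : Type*} [MeasurableSpace Ω]
    (Λ : Set (ℝ≥0 × ℝ) → Ω → ℝ) (P : Measure Ω) (a : ℝ) : Prop :=
  ∀ A : Set (ℝ≥0 × ℝ), MeasurableSet A → Bornology.IsBounded A →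
    Integrable (fun ω => |Λ A ω| ^ a) P

/-- The partial order `(s, y) ⪯ (t, x)` on `ℝ₊ × ℝ`: `s ≤ t` and `|x - y| ≤ c (t - s)`. -/
def ConeLE (c : ℝ) (r q : ℝ≥0 × ℝ) : Prop :=
  r.1 ≤ q.1 ∧ |q.2 - r.2| ≤ c * ((q.1 : ℝ) - (r.1 : ℝ))

/-- The closed interval `[p, q]` with respect to `⪯`. -/
def coneInterval (c : ℝ) (p q : ℝ≥0 × ℝ) : Set (ℝ≥0 × ℝ) :=
  {r | ConeLE c p r ∧ ConeLE c r q}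

/-- The truncated backward light cone `A⁺(t, x) = ((t, x) - {(s, y) : s ≥ 0, |y| ≤ c s}) ∩ ℝ₊ × ℝ`. -/
def backwardCone (c : ℝ) (q : ℝ≥0 × ℝ) : Set (ℝ≥0 × ℝ) :=
  {r | 0 ≤ (q.1 : ℝ) - (r.1 : ℝ) ∧ |q.2 - r.2| ≤ c * ((q.1 : ℝ) - (r.1 : ℝ))}

/-- `Y` is a version (modification) of `X`. -/
def IsVersion {Ω T : Type*} [MeasurableSpace Ω] (Y X : T → Ω → ℝ) (P : Measure Ω) : Prop :=
  ∀ r, Y r =ᵐ[P] X r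

/-- Separability, in the sense of Doob, of the process `(Y r)`, `r ∈ I`: there is a countable
`D ⊆ I` such that, almost surely, for all `r ∈ I` the value of the path at `r` is a limit of values
at points of `D` that tend to `r`. -/
def IsSeparableOn {Ω T : Type*} [MeasurableSpace Ω] [TopologicalSpace T]
    (Y : T → Ω → ℝ) (I : Set T) (P : Measure Ω) : Prop :=
  ∃ D : Set T, D.Countable ∧ D ⊆ I ∧
    ∀ᵐ ω ∂P, ∀ r ∈ I, ∀ U ∈ 𝓝 r, Y r ω ∈ closure ((fun u => Y u ω) '' (D ∩ U))

/-! In the light-ray coordinates `c t + x` and `c t - x` the order `ConeLE` becomes the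
coordinatewise order and a backward cone becomes a quadrant, cut off at time zero and therefore
bounded. Finitely many cones below `q` thus cut out a finite grid of disjoint cells. Up to null
sets, the values of `Λ` on these cones are two-parameter partial sums `S i j` of independent centred
variables, and the cone of `q` gives the last one, `S m n`.

For such sums Cairoli's argument applies. For each `j` the sequence `i ↦ S i j` is a martingale, and
one filtration serves all `j`, so `i ↦ max_j |S i j|` is a nonnegative submartingale. Doob's
inequality in `i` leaves `max_j |S m j|`, a one-parameter maximum. For `p > 1` a second use of
Doob's `L^p` inequality gives the constant `(p / (p - 1)) ^ (2 * p)`. For the weak-type bound the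
`L¹` norm of that maximum is needed, which Doob's inequality does not control; independence of
increments does, through Ottaviani's inequality, with constant 6, which is below the claimed 13.

Monotone limits extend both bounds from finite to countable families of cones, and separability
reduces the supremum over the interval to a countable one. A separable version exists because `Λ` is
almost surely continuous along decreasing sequences of cones, and because the weak-type bound makes
the values on a countable set almost surely bounded, so that limit values exist by compactness. -/

/-! ### Doob's inequalities for running maxima -/

/-- A weak-type maximal inequality implies the strong `L^p` inequality. -/
theorem lintegral_rpow_le_of_maximal_ineq {Ω : Type*} [MeasurableSpace Ω] {P : Measure Ω}
    [IsFiniteMeasure P] {M f : Ω → ℝ} (hM : Measurable M) (hM0 : ∀ ω, 0 ≤ M ω)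
    (hf : Measurable f) {p : ℝ} (hp : 1 < p)
    (hweak : ∀ t : ℝ, 0 < t → ENNReal.ofReal t * P {ω | t ≤ M ω} ≤
      ∫⁻ ω in {ω | t ≤ M ω}, ENNReal.ofReal (f ω) ∂P)
    (hfin : ∫⁻ ω, ENNReal.ofReal (M ω ^ p) ∂P ≠ ∞) :
    ∫⁻ ω, ENNReal.ofReal (M ω ^ p) ∂P ≤
      ENNReal.ofReal ((p / (p - 1)) ^ p) * ∫⁻ ω, ENNReal.ofReal (f ω) ^ p ∂P := by
  have hp1 : 0 < p - 1 := by linarith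
  have hp0 : 0 < p := by linarith
  have hfm : Measurable fun ω => ENNReal.ofReal (f ω) := hf.ennreal_ofReal
  set ν := P.withDensity fun ω => ENNReal.ofReal (f ω) with hν
  have hset (t : ℝ) : MeasurableSet {ω | t ≤ M ω} := measurableSet_le measurable_const hM
  -- Layer-cake formula twice: exponent `p` under `P`, exponent `p - 1` under `ν = f dP`. The
  -- weak-type bound compares the two integrands in `t`, and the prefactors `p` and `p - 1` leave
  -- the ratio `p / (p - 1)`.
  have h1 : ∫⁻ ω, ENNReal.ofReal (M ω ^ p) ∂P ≤
      ENNReal.ofReal (p / (p - 1)) *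
        ∫⁻ ω, ENNReal.ofReal (f ω) * ENNReal.ofReal (M ω ^ (p - 1)) ∂P := by
    have e1 := lintegral_rpow_eq_lintegral_meas_le_mul P (Eventually.of_forall hM0)
      hM.aemeasurable hp0
    have e2 := lintegral_rpow_eq_lintegral_meas_le_mul ν (Eventually.of_forall hM0)
      hM.aemeasurable hp1
    have e3 : ∫⁻ ω, ENNReal.ofReal (M ω ^ (p - 1)) ∂ν =
        ∫⁻ ω, ENNReal.ofReal (f ω) * ENNReal.ofReal (M ω ^ (p - 1)) ∂P := by
      rw [hν, lintegral_withDensity_eq_lintegral_mul _ hfm (by fun_prop)]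
      rfl
    rw [← e3, e1, e2, ← mul_assoc, ← ENNReal.ofReal_mul (by positivity),
      div_mul_cancel₀ _ hp1.ne']
    gcongr 1
    refine setLIntegral_mono' measurableSet_Ioi fun t ht => ?_
    have ht : 0 < t := ht
    have e4 : ENNReal.ofReal (t ^ (p - 1)) =
        ENNReal.ofReal t * ENNReal.ofReal (t ^ (p - 1 - 1)) := by
      rw [← ENNReal.ofReal_mul ht.le, Real.rpow_sub_one ht.ne' (p - 1)]
      congr 1
      field_simp
    rw [e4, ← mul_assoc, mul_comm (P _)]
    gcongr
    rw [hν, withDensity_apply _ (hset t)]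
    exact hweak t ht
  set A := ∫⁻ ω, ENNReal.ofReal (M ω ^ p) ∂P with hA
  set B := ∫⁻ ω, ENNReal.ofReal (f ω) ^ p ∂P with hB
  have hpq : p.HolderConjugate (p / (p - 1)) := Real.HolderConjugate.conjExponent hp
  have h2 : ∫⁻ ω, ENNReal.ofReal (f ω) * ENNReal.ofReal (M ω ^ (p - 1)) ∂P ≤
      B ^ (1 / p) * A ^ (1 / (p / (p - 1))) := by
    refine (ENNReal.lintegral_mul_le_Lp_mul_Lq P hpq hfm.aemeasurable
      (g := fun ω => ENNReal.ofReal (M ω ^ (p - 1))) (by fun_prop)).trans_eq ?_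
    rw [hA]
    congr 3
    ext ω
    rw [ENNReal.ofReal_rpow_of_nonneg (by have := hM0 ω; positivity) (by positivity),
      ← Real.rpow_mul (hM0 ω)]
    congr 2
    field_simp
  -- Hölder leaves a power of `A` on the right. Cancelling it requires `A` to be nonzero and finite,
  -- which is the role of `hfin`.
  rcases eq_or_ne A 0 with h0 | h0
  · simp [h0]
  have h3 : A ≤ ENNReal.ofReal (p / (p - 1)) * B ^ (1 / p) * A ^ (1 / (p / (p - 1))) := by
    refine h1.trans ?_
    rw [mul_assoc]
    gcongr
  have h4 : A ^ (1 / p) ≤ ENNReal.ofReal (p / (p - 1)) * B ^ (1 / p) := by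
    have hA' : A ^ (1 / (p / (p - 1))) ≠ 0 := by simp [ENNReal.rpow_eq_zero_iff, h0, hfin]
    have hA'' : A ^ (1 / (p / (p - 1))) ≠ ∞ := ENNReal.rpow_ne_top_of_nonneg (by positivity) hfin
    rw [← ENNReal.mul_le_mul_iff_left hA' hA'']
    refine le_trans (le_of_eq ?_) h3
    rw [← ENNReal.rpow_add _ _ h0 hfin]
    have : 1 / p + 1 / (p / (p - 1)) = 1 := by field_simp; ring
    rw [this, ENNReal.rpow_one]
  calc A = (A ^ (1 / p)) ^ p := by
        rw [← ENNReal.rpow_mul, one_div_mul_cancel hp0.ne', ENNReal.rpow_one]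
    _ ≤ (ENNReal.ofReal (p / (p - 1)) * B ^ (1 / p)) ^ p := by gcongr
    _ = _ := by
      rw [ENNReal.mul_rpow_of_nonneg _ _ hp0.le, ← ENNReal.rpow_mul, one_div_mul_cancel hp0.ne',
        ENNReal.rpow_one, ENNReal.ofReal_rpow_of_nonneg (by positivity) hp0.le]

/-- The running maximum `max (f 0, …, f n)`. -/
noncomputable def runMax {Ω : Type*} (f : ℕ → Ω → ℝ) (n : ℕ) (ω : Ω) : ℝ :=
  (Finset.range (n + 1)).sup' Finset.nonempty_range_add_one fun k => f k ω

theorem le_runMax {Ω : Type*} (f : ℕ → Ω → ℝ) {k n : ℕ} (h : k ≤ n) (ω : Ω) :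
    f k ω ≤ runMax f n ω :=
  Finset.le_sup' (fun k => f k ω) (Finset.mem_range.2 (by omega))

theorem lt_runMax_iff {Ω : Type*} {f : ℕ → Ω → ℝ} {n : ℕ} {ω : Ω} {t : ℝ} :
    t < runMax f n ω ↔ ∃ k ≤ n, t < f k ω := by
  simp [runMax]

theorem runMax_le_iff {Ω : Type*} {f : ℕ → Ω → ℝ} {n : ℕ} {ω : Ω} {t : ℝ} :
    runMax f n ω ≤ t ↔ ∀ k ≤ n, f k ω ≤ t := by
  simp [runMax]

theorem exists_runMax_eq {Ω : Type*} (f : ℕ → Ω → ℝ) (n : ℕ) (ω : Ω) :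
    ∃ k ≤ n, runMax f n ω = f k ω := by
  obtain ⟨k, hk, h⟩ := Finset.exists_mem_eq_sup' (Finset.nonempty_range_add_one (n := n))
    fun k => f k ω
  exact ⟨k, by simpa [Nat.lt_succ_iff] using hk, h⟩

theorem measurable_runMax {Ω : Type*} [MeasurableSpace Ω] {f : ℕ → Ω → ℝ}
    (hf : ∀ k, Measurable (f k)) (n : ℕ) : Measurable (runMax f n) :=
  Finset.measurable_range_sup'' fun k _ => hf k

theorem runMax_zero {Ω : Type*} (f : ℕ → Ω → ℝ) : runMax f 0 = f 0 := by
  ext ω; simp [runMax]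

theorem runMax_succ {Ω : Type*} (f : ℕ → Ω → ℝ) (n : ℕ) :
    runMax f (n + 1) = runMax f n ⊔ f (n + 1) := by
  ext ω
  refine le_antisymm (runMax_le_iff.2 fun k hk => ?_) (sup_le ?_ (le_runMax _ le_rfl ω))
  · rcases Nat.lt_or_eq_of_le hk with h | rfl
    · exact le_sup_of_le_left (le_runMax f (by omega) ω)
    · exact le_sup_right
  · exact runMax_le_iff.2 fun k hk => le_runMax f (by omega) ω

theorem runMax_nonneg {Ω : Type*} {f : ℕ → Ω → ℝ} (hf : ∀ k ω, 0 ≤ f k ω) (n : ℕ) (ω : Ω) :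
    0 ≤ runMax f n ω :=
  (hf 0 ω).trans (le_runMax f (Nat.zero_le n) ω)

/-- The `p`-th moment of a running maximum is finite if all the `p`-th moments are. -/
theorem lintegral_runMax_rpow_ne_top {Ω : Type*} [MeasurableSpace Ω] {P : Measure Ω}
    {f : ℕ → Ω → ℝ} (hf : ∀ k, Measurable (f k)) {p : ℝ}
    (n : ℕ) (hfin : ∀ k ≤ n, ∫⁻ ω, ENNReal.ofReal (f k ω ^ p) ∂P ≠ ∞) :
    ∫⁻ ω, ENNReal.ofReal (runMax f n ω ^ p) ∂P ≠ ∞ := by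
  have : ∫⁻ ω, ENNReal.ofReal (runMax f n ω ^ p) ∂P ≤
      ∑ k ∈ Finset.range (n + 1), ∫⁻ ω, ENNReal.ofReal (f k ω ^ p) ∂P := by
    rw [← lintegral_finsetSum _ (fun k _ => ((hf k).pow_const p).ennreal_ofReal)]
    refine lintegral_mono fun ω => ?_
    obtain ⟨k, hk, h⟩ := exists_runMax_eq f n ω
    rw [h]
    exact Finset.single_le_sum (f := fun k => ENNReal.ofReal (f k ω ^ p))
      (fun _ _ => zero_le) (Finset.mem_range.2 (by omega))
  refine ne_top_of_le_ne_top ?_ this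
  rw [ENNReal.sum_ne_top]
  exact fun k hk => hfin k (by simpa [Nat.lt_succ_iff] using hk)

theorem MeasureTheory.Submartingale.maximal_ineq_runMax {Ω : Type*} [m0 : MeasurableSpace Ω]
    {P : Measure Ω} [IsFiniteMeasure P] {𝒢 : Filtration ℕ m0} {f : ℕ → Ω → ℝ}
    (hf : Submartingale f 𝒢 P) (h0 : ∀ k ω, 0 ≤ f k ω) (n : ℕ) {t : ℝ} (ht : 0 < t) :
    ENNReal.ofReal t * P {ω | t ≤ runMax f n ω} ≤
      ∫⁻ ω in {ω | t ≤ runMax f n ω}, ENNReal.ofReal (f n ω) ∂P := by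
  have h := maximal_ineq hf (fun k ω => h0 k ω) (ε := ⟨t, ht.le⟩) n
  rw [ofReal_integral_eq_lintegral_ofReal (hf.integrable n).integrableOn
    (Eventually.of_forall (h0 n))] at h
  rw [ENNReal.ofReal_eq_coe_nnreal ht.le]
  exact h

/-- **Doob's `L^p` inequality**. -/
theorem MeasureTheory.Submartingale.lintegral_runMax_rpow_le {Ω : Type*} [m0 : MeasurableSpace Ω]
    {P : Measure Ω} [IsFiniteMeasure P] {𝒢 : Filtration ℕ m0} {f : ℕ → Ω → ℝ}
    (hf : Submartingale f 𝒢 P) (h0 : ∀ k ω, 0 ≤ f k ω) (n : ℕ) {p : ℝ} (hp : 1 < p)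
    (hfin : ∀ k ≤ n, ∫⁻ ω, ENNReal.ofReal (f k ω ^ p) ∂P ≠ ∞) :
    ∫⁻ ω, ENNReal.ofReal (runMax f n ω ^ p) ∂P ≤
      ENNReal.ofReal ((p / (p - 1)) ^ p) * ∫⁻ ω, ENNReal.ofReal (f n ω ^ p) ∂P := by
  have hm (k : ℕ) : Measurable (f k) := ((hf.stronglyMeasurable k).mono (𝒢.le k)).measurable
  have := lintegral_rpow_le_of_maximal_ineq (P := P) (measurable_runMax hm n) (runMax_nonneg h0 n)
    (hm n) hp (fun t ht => hf.maximal_ineq_runMax h0 n ht)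
    (lintegral_runMax_rpow_ne_top hm n hfin)
  refine this.trans_eq ?_
  congr 1
  refine lintegral_congr fun ω => ?_
  rw [ENNReal.ofReal_rpow_of_nonneg (h0 n ω) (by linarith)]

theorem MeasureTheory.Martingale.submartingale_abs {Ω : Type*} [m0 : MeasurableSpace Ω]
    {P : Measure Ω} {𝒢 : Filtration ℕ m0} {f : ℕ → Ω → ℝ}
    (hf : Martingale f 𝒢 P) : Submartingale (fun k ω => |f k ω|) 𝒢 P :=
  hf.submartingale.sup hf.neg.submartingale

/-- The maximum of two submartingales for the same filtration is a submartingale. This lets Doob's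
inequality act in one index after the maximum over the other has been taken. -/
theorem submartingale_runMax {Ω : Type*} [m0 : MeasurableSpace Ω]
    {P : Measure Ω} {𝒢 : Filtration ℕ m0} {f : ℕ → ℕ → Ω → ℝ}
    (hf : ∀ j, Submartingale (fun i => f i j) 𝒢 P) (n : ℕ) :
    Submartingale (fun i => runMax (f i) n) 𝒢 P := by
  induction n with
  | zero => simpa only [runMax_zero] using hf 0
  | succ n ih =>
    simp only [runMax_succ]
    exact ih.sup (hf (n + 1))

/-! ### Ottaviani's inequality and the `L¹` bound on the maximum -/

/-- **Ottaviani's inequality** for a process whose increments up to the terminal time `n` are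
independent of the past. -/
theorem measure_lt_runMax_abs_le {Ω : Type*} [m0 : MeasurableSpace Ω] {P : Measure Ω}
    {𝒢 : Filtration ℕ m0} {R : ℕ → Ω → ℝ} (hR : ∀ i, Measurable[𝒢 i] (R i)) (n : ℕ)
    (hind : ∀ i ≤ n, Indep (𝒢 i) (MeasurableSpace.comap (R n - R i) inferInstance) P)
    {y : ℝ} (hy : ∀ i ≤ n, 1 ≤ 2 * P {ω | |R n ω - R i ω| ≤ y}) (x : ℝ) :
    P {ω | x + y < runMax (fun k ω => |R k ω|) n ω} ≤ 2 * P {ω | x < |R n ω|} := by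
  -- `E i` says that `|R|` first exceeds `x + y` at time `i`. It depends only on the past of `i`,
  -- while `G i` depends only on the later increment. On `E i ∩ G i` the terminal value still
  -- satisfies `|R n| > x`.
  set E : ℕ → Set Ω := fun i => {ω | x + y < |R i ω| ∧ ∀ k < i, |R k ω| ≤ x + y} with hE
  set G : ℕ → Set Ω := fun i => {ω | |R n ω - R i ω| ≤ y} with hG
  have hRm (i : ℕ) : Measurable (R i) := (hR i).mono (𝒢.le i) le_rfl
  have hEm (i : ℕ) : MeasurableSet[𝒢 i] (E i) := by
    have e : E i = {ω | x + y < |R i ω|} ∩ ⋂ k ∈ Set.Iio i, {ω | |R k ω| ≤ x + y} := by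
      ext ω; simp [hE]
    rw [e]
    refine MeasurableSet.inter ?_ (MeasurableSet.biInter (Set.to_countable _) fun k hk => ?_)
    · exact (hR i) (measurableSet_lt measurable_const measurable_norm)
    · exact 𝒢.mono (le_of_lt hk) _
        ((hR k) (measurableSet_le measurable_norm measurable_const))
  have hGm (i : ℕ) :
      MeasurableSet[MeasurableSpace.comap (R n - R i) inferInstance] (G i) :=
    ⟨{z | |z| ≤ y}, measurableSet_le measurable_norm measurable_const, rfl⟩
  have hGm' (i : ℕ) : MeasurableSet (G i) :=
    measurableSet_le ((hRm n).sub (hRm i)).norm measurable_const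
  have hdisj : Pairwise (Function.onFun Disjoint E) := by
    refine fun i j hij => Set.disjoint_left.2 fun ω h1 h2 => ?_
    rcases lt_or_gt_of_ne hij with h | h
    · exact absurd (h2.2 i h) (not_le.2 h1.1)
    · exact absurd (h1.2 j h) (not_le.2 h2.1)
  calc P {ω | x + y < runMax (fun k ω => |R k ω|) n ω}
      ≤ P (⋃ i ∈ Finset.range (n + 1), E i) := by
        refine measure_mono fun ω hω => ?_
        have hex : ∃ k, x + y < |R k ω| := by
          obtain ⟨k, -, hk⟩ := lt_runMax_iff.1 hω
          exact ⟨k, hk⟩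
        obtain ⟨k, hkn, hk⟩ := lt_runMax_iff.1 hω
        classical
        simp only [Set.mem_iUnion, Finset.mem_range]
        refine ⟨Nat.find hex, ?_, Nat.find_spec hex, fun j hj => not_lt.1 (Nat.find_min hex hj)⟩
        exact Nat.lt_succ_of_le ((Nat.find_min' hex hk).trans hkn)
    _ ≤ ∑ i ∈ Finset.range (n + 1), P (E i) := measure_biUnion_finset_le _ _
    _ ≤ ∑ i ∈ Finset.range (n + 1), 2 * P (E i ∩ G i) := by
        refine Finset.sum_le_sum fun i hi => ?_
        have hi : i ≤ n := by simpa [Nat.lt_succ_iff] using hi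
        rw [(Indep_iff _ _ _).1 (hind i hi) _ _ (hEm i) (hGm i)]
        calc P (E i) = P (E i) * 1 := (mul_one _).symm
          _ ≤ P (E i) * (2 * P (G i)) := by gcongr; exact hy i hi
          _ = _ := by ring
    _ = 2 * P (⋃ i ∈ Finset.range (n + 1), E i ∩ G i) := by
        rw [← Finset.mul_sum, measure_biUnion_finset]
        · intro i _ j _ hij
          exact (hdisj hij).mono Set.inter_subset_left Set.inter_subset_left
        · exact fun i _ => (𝒢.le i _ (hEm i)).inter (hGm' i)
    _ ≤ 2 * P {ω | x < |R n ω|} := by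
        gcongr
        refine Set.iUnion₂_subset fun i _ ω hω => ?_
        have h1 : x + y < |R i ω| := hω.1.1
        have h2 : |R n ω - R i ω| ≤ y := hω.2
        have h3 : |R i ω| ≤ |R n ω| + |R n ω - R i ω| := by
          have := abs_sub (R n ω) (R n ω - R i ω)
          simpa using this
        change x < |R n ω|
        linarith

/-- Ottaviani's inequality integrated over the level: the tail of `(M - y)⁺` at `t > 0` is at most
twice the tail of `|R n|`, and the shift costs the additive `y`. -/
theorem lintegral_runMax_abs_le_add {Ω : Type*} [m0 : MeasurableSpace Ω] {P : Measure Ω}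
    [IsProbabilityMeasure P]
    {𝒢 : Filtration ℕ m0} {R : ℕ → Ω → ℝ} (hR : ∀ i, Measurable[𝒢 i] (R i)) (n : ℕ)
    (hind : ∀ i ≤ n, Indep (𝒢 i) (MeasurableSpace.comap (R n - R i) inferInstance) P)
    {y : ℝ} (hy : ∀ i ≤ n, 1 ≤ 2 * P {ω | |R n ω - R i ω| ≤ y}) :
    ∫⁻ ω, ENNReal.ofReal (runMax (fun k ω => |R k ω|) n ω) ∂P ≤
      ENNReal.ofReal y + 2 * ∫⁻ ω, ENNReal.ofReal |R n ω| ∂P := by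
  have hRm (i : ℕ) : Measurable (R i) := (hR i).mono (𝒢.le i) le_rfl
  set M := runMax (fun k ω => |R k ω|) n with hM
  have hMm : Measurable M := measurable_runMax (fun k => (hRm k).norm) n
  have h1 : ∫⁻ ω, ENNReal.ofReal (max (M ω - y) 0) ∂P ≤ 2 * ∫⁻ ω, ENNReal.ofReal |R n ω| ∂P := by
    rw [lintegral_eq_lintegral_meas_lt P (f := fun ω => max (M ω - y) 0)
        (Eventually.of_forall fun ω => le_max_right _ _) (by fun_prop),
      lintegral_eq_lintegral_meas_lt P (Eventually.of_forall fun ω => abs_nonneg _)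
        (hRm n).norm.aemeasurable,
      ← lintegral_const_mul' _ _ (by simp)]
    refine setLIntegral_mono' measurableSet_Ioi fun t ht => ?_
    refine le_trans (measure_mono fun ω hω => ?_) (measure_lt_runMax_abs_le hR n hind hy t)
    have ht : 0 < t := ht
    rcases lt_max_iff.1 (show t < max (M ω - y) 0 from hω) with h | h
    · change t + y < M ω
      linarith
    · exact absurd h (not_lt.2 ht.le)
  calc ∫⁻ ω, ENNReal.ofReal (M ω) ∂P
      ≤ ∫⁻ ω, (ENNReal.ofReal y + ENNReal.ofReal (max (M ω - y) 0)) ∂P := by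
        refine lintegral_mono fun ω => ?_
        refine le_trans (ENNReal.ofReal_le_ofReal ?_) ENNReal.ofReal_add_le
        have := le_max_left (M ω - y) 0
        linarith
    _ = ENNReal.ofReal y + ∫⁻ ω, ENNReal.ofReal (max (M ω - y) 0) ∂P := by
        rw [lintegral_add_left measurable_const]; simp
    _ ≤ _ := by gcongr

/-- A martingale with increments independent of the past satisfies `E max |R| ≤ 6 E |R n|`. -/
theorem lintegral_runMax_abs_le {Ω : Type*} [m0 : MeasurableSpace Ω] {P : Measure Ω}
    [IsProbabilityMeasure P]
    {𝒢 : Filtration ℕ m0} {R : ℕ → Ω → ℝ} (hR : Martingale R 𝒢 P) (n : ℕ)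
    (hind : ∀ i ≤ n, Indep (𝒢 i) (MeasurableSpace.comap (R n - R i) inferInstance) P) :
    ∫⁻ ω, ENNReal.ofReal (runMax (fun k ω => |R k ω|) n ω) ∂P ≤
      6 * ∫⁻ ω, ENNReal.ofReal |R n ω| ∂P := by
  set m := ∫ ω, |R n ω| ∂P with hm
  have hm0 : 0 ≤ m := integral_nonneg fun ω => abs_nonneg _
  have hmE : ∫⁻ ω, ENNReal.ofReal |R n ω| ∂P = ENNReal.ofReal m :=
    (ofReal_integral_eq_lintegral_ofReal (hR.integrable n).abs
      (Eventually.of_forall fun ω => abs_nonneg _)).symm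
  have hmeas (i : ℕ) : Measurable (R i) := ((hR.stronglyMeasurable i).mono (𝒢.le i)).measurable
  have hle (i : ℕ) (hi : i ≤ n) : ∫ ω, |R n ω - R i ω| ∂P ≤ 2 * m := by
    have h1 : ∫ ω, |R i ω| ∂P ≤ m := by
      simpa using hR.submartingale_abs.setIntegral_le hi MeasurableSet.univ
    calc ∫ ω, |R n ω - R i ω| ∂P ≤ ∫ ω, (|R n ω| + |R i ω|) ∂P :=
          integral_mono ((hR.integrable n).sub (hR.integrable i)).abs
            ((hR.integrable n).abs.add (hR.integrable i).abs) fun ω => abs_sub _ _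
      _ = m + ∫ ω, |R i ω| ∂P := integral_add (hR.integrable n).abs (hR.integrable i).abs
      _ ≤ 2 * m := by linarith
  -- Since `E |R n - R i| ≤ 2 m`, Markov's inequality at level `4 m` leaves probability at most one
  -- half. The constant is `6 = 4 + 2`.
  have key := lintegral_runMax_abs_le_add (y := 4 * m)
    (fun i => (hR.stronglyMeasurable i).measurable) n hind ?_
  · refine key.trans_eq ?_
    rw [hmE, ENNReal.ofReal_mul (by norm_num), ← add_mul]
    congr 1
    norm_num
  · intro i hi
    set Z : Ω → ℝ := fun ω => |R n ω - R i ω| with hZ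
    have hZi : Integrable Z P := ((hR.integrable n).sub (hR.integrable i)).abs
    have hS : MeasurableSet {ω | Z ω ≤ 4 * m} :=
      measurableSet_le ((hmeas n).sub (hmeas i)).norm measurable_const
    have hc : {ω | Z ω ≤ 4 * m}ᶜ = {ω | 4 * m < Z ω} := by ext ω; simp
    have hhalf : P.real {ω | 4 * m < Z ω} ≤ 1 / 2 := by
      -- Markov's inequality says nothing at level zero; if `m = 0` the increment vanishes almost
      -- surely.
      rcases hm0.eq_or_lt with h | h
      · have hz : Z =ᵐ[P] 0 := by
          rw [← integral_eq_zero_iff_of_nonneg (fun ω => abs_nonneg _) hZi]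
          exact le_antisymm (by linarith [hle i hi]) (integral_nonneg fun ω => abs_nonneg _)
        have : P {ω | 4 * m < Z ω} = 0 := by
          rw [← h]
          refine measure_mono_null (fun ω hω => ?_) (ae_iff.1 hz)
          simp only [Set.mem_ofPred_eq, mul_zero] at hω ⊢
          exact hω.ne'
        simp [measureReal_def, this]
      · have h1 := mul_meas_ge_le_integral_of_nonneg (μ := P)
          (Eventually.of_forall fun ω => abs_nonneg (R n ω - R i ω)) hZi (4 * m)
        have h2 : P.real {ω | 4 * m < Z ω} ≤ P.real {ω | 4 * m ≤ Z ω} :=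
          measureReal_mono fun ω (hω : 4 * m < Z ω) => show 4 * m ≤ Z ω from hω.le
        have h3 : 4 * m * P.real {ω | 4 * m ≤ Z ω} ≤ 4 * m * (1 / 2) := by
          linarith [hle i hi, h1]
        exact h2.trans (le_of_mul_le_mul_left h3 (by linarith))
    have h4 : 1 / 2 ≤ P.real {ω | Z ω ≤ 4 * m} := by
      have := probReal_add_probReal_compl (μ := P) hS
      rw [hc] at this
      linarith
    have h5 : P {ω | Z ω ≤ 4 * m} = ENNReal.ofReal (P.real {ω | Z ω ≤ 4 * m}) := by simp
    change 1 ≤ 2 * P {ω | Z ω ≤ 4 * m}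
    rw [h5, show (2 : ℝ≥0∞) = ENNReal.ofReal 2 by simp, ← ENNReal.ofReal_mul (by norm_num)]
    rw [ENNReal.one_le_ofReal]
    linarith

/-! ### Partial sums of independent centred variables -/

/-- The filtration generated by a family `ξ` graded by `f`. -/
def gradedFiltration {Ω ι : Type*} [m0 : MeasurableSpace Ω] (ξ : ι → Ω → ℝ)
    (hξ : ∀ k, Measurable (ξ k)) (f : ι → ℕ) : Filtration ℕ m0 where
  seq i := ⨆ k ∈ {k | f k ≤ i}, MeasurableSpace.comap (ξ k) inferInstance
  mono' _ _ hij := biSup_mono fun _ hk => le_trans hk hij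
  le' _ := iSup₂_le fun k _ => (hξ k).comap_le

theorem measurable_sum_biSup {Ω ι : Type*} (ξ : ι → Ω → ℝ) (S : Set ι) (s : Finset ι)
    (hs : ∀ k ∈ s, k ∈ S) :
    Measurable[⨆ k ∈ S, MeasurableSpace.comap (ξ k) inferInstance] (∑ k ∈ s, ξ k) := by
  rw [Finset.sum_fn]
  refine Finset.measurable_sum s fun k hk => ?_
  exact (comap_measurable (ξ k)).mono (le_iSup₂_of_le k (hs k hk) le_rfl) le_rfl

theorem sum_filter_sub_sum_filter {Ω ι : Type*} (ξ : ι → Ω → ℝ) (f : ι → ℕ) (s : Finset ι) {i n : ℕ}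
    (h : i ≤ n) :
    ∑ k ∈ s with f k ≤ n, ξ k - ∑ k ∈ s with f k ≤ i, ξ k =
      ∑ k ∈ s with f k ≤ n ∧ i < f k, ξ k := by
  rw [sub_eq_iff_eq_add', ← Finset.sum_filter_add_sum_filter_not (s.filter fun k => f k ≤ n)
    (fun k => f k ≤ i), Finset.filter_filter, Finset.filter_filter]
  congr 1
  · refine Finset.sum_congr (Finset.filter_congr fun k _ => ?_) fun _ _ => rfl
    omega
  · refine Finset.sum_congr (Finset.filter_congr fun k _ => ?_) fun _ _ => rfl
    omega

section GradedSum

variable {Ω ι : Type*} [m0 : MeasurableSpace Ω] {P : Measure Ω} {ξ : ι → Ω → ℝ}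

/-- Variables of grade at most `i` and those of grade above `i` form disjoint subfamilies, so they
generate independent σ-algebras. -/
theorem indep_gradedFiltration_sum (hξ : ∀ k, Measurable (ξ k)) (hind : iIndepFun ξ P)
    (f : ι → ℕ) (i : ℕ) (s : Finset ι) (hs : ∀ k ∈ s, i < f k) :
    Indep (gradedFiltration ξ hξ f i)
      (MeasurableSpace.comap (∑ k ∈ s, ξ k) inferInstance) P := by
  have h := indep_iSup_of_disjoint (fun k => (hξ k).comap_le) hind
    (S := {k | f k ≤ i}) (T := {k | i < f k})
    (Set.disjoint_left.2 fun k (hk : f k ≤ i) (hk' : i < f k) => absurd hk (not_le.2 hk'))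
  exact indep_of_indep_of_le_right h (measurable_sum_biSup ξ _ s hs).comap_le

theorem martingale_sum_filter [IsProbabilityMeasure P] (hξ : ∀ k, Measurable (ξ k))
    (hind : iIndepFun ξ P) (hint : ∀ k, Integrable (ξ k) P) (hmean : ∀ k, ∫ ω, ξ k ω ∂P = 0)
    (f : ι → ℕ) (s : Finset ι) :
    Martingale (fun i => ∑ k ∈ s with f k ≤ i, ξ k) (gradedFiltration ξ hξ f) P := by
  have hmeas (t : Finset ι) : Measurable (∑ k ∈ t, ξ k) := by
    rw [Finset.sum_fn]
    exact Finset.measurable_sum t fun k _ => hξ k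
  have hinteg (t : Finset ι) : Integrable (∑ k ∈ t, ξ k) P :=
    integrable_finsetSum' t fun k _ => hint k
  refine martingale_of_condExp_sub_eq_zero_nat (fun i => ?_) (fun i => hinteg _) fun i => ?_
  · exact (measurable_sum_biSup ξ {k | f k ≤ i} _ fun k hk =>
      (Finset.mem_filter.1 hk).2).stronglyMeasurable
  · rw [sum_filter_sub_sum_filter ξ f s (Nat.le_succ i)]
    refine (condExp_indep_eq (hmeas _).comap_le ((gradedFiltration ξ hξ f).le i)
      (comap_measurable _).stronglyMeasurable
      (indep_gradedFiltration_sum hξ hind f i _ fun k hk =>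
        (Finset.mem_filter.1 hk).2.2).symm).trans ?_
    refine Eventually.of_forall fun ω => ?_
    simp only [Finset.sum_apply, Pi.zero_apply]
    rw [integral_finsetSum _ fun k _ => hint k]
    simp [hmean]

theorem lintegral_runMax_abs_sum_filter_le [IsProbabilityMeasure P] (hξ : ∀ k, Measurable (ξ k))
    (hind : iIndepFun ξ P) (hint : ∀ k, Integrable (ξ k) P) (hmean : ∀ k, ∫ ω, ξ k ω ∂P = 0)
    (f : ι → ℕ) (s : Finset ι) (n : ℕ) :
    ∫⁻ ω, ENNReal.ofReal (runMax (fun i ω => |(∑ k ∈ s with f k ≤ i, ξ k) ω|) n ω) ∂P ≤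
      6 * ∫⁻ ω, ENNReal.ofReal |(∑ k ∈ s with f k ≤ n, ξ k) ω| ∂P := by
  refine lintegral_runMax_abs_le (martingale_sum_filter hξ hind hint hmean f s) n fun i hi => ?_
  rw [sum_filter_sub_sum_filter ξ f s hi]
  exact indep_gradedFiltration_sum hξ hind f i _ fun k hk => (Finset.mem_filter.1 hk).2.2

end GradedSum

/-! ### Cairoli's inequalities for two-parameter sums -/

/-- The two-parameter partial sums of the family `ξ` over the finite index set `T`. -/
noncomputable def gridSum {Ω : Type*} (ξ : ℕ × ℕ → Ω → ℝ) (T : Finset (ℕ × ℕ)) (i j : ℕ) : Ω → ℝ :=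
  ∑ k ∈ T with k.1 ≤ i ∧ k.2 ≤ j, ξ k

theorem gridSum_eq_fst {Ω : Type*} (ξ : ℕ × ℕ → Ω → ℝ) (T : Finset (ℕ × ℕ)) (i j : ℕ) :
    gridSum ξ T i j = ∑ k ∈ T.filter (fun k => k.2 ≤ j) with k.1 ≤ i, ξ k := by
  rw [gridSum, Finset.filter_filter]
  simp only [and_comm]

theorem gridSum_eq_snd {Ω : Type*} (ξ : ℕ × ℕ → Ω → ℝ) (T : Finset (ℕ × ℕ)) (i j : ℕ) :
    gridSum ξ T i j = ∑ k ∈ T.filter (fun k => k.1 ≤ i) with k.2 ≤ j, ξ k := by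
  rw [gridSum, Finset.filter_filter]

section Grid

variable {Ω : Type*} [m0 : MeasurableSpace Ω] {P : Measure Ω} [IsProbabilityMeasure P]
  {ξ : ℕ × ℕ → Ω → ℝ}

/-- The filtration looks only at the first index and at step `i` contains every `ξ (i', j)` with `i'
≤ i`, whatever `j` is. The same filtration therefore works for all `j`, as taking the maximum
requires. -/
theorem submartingale_runMax_gridSum (hξ : ∀ k, Measurable (ξ k)) (hind : iIndepFun ξ P)
    (hint : ∀ k, Integrable (ξ k) P) (hmean : ∀ k, ∫ ω, ξ k ω ∂P = 0) (T : Finset (ℕ × ℕ))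
    (n : ℕ) :
    Submartingale (fun i => runMax (fun j ω => |gridSum ξ T i j ω|) n)
      (gradedFiltration ξ hξ Prod.fst) P := by
  refine submartingale_runMax (f := fun i j ω => |gridSum ξ T i j ω|) (fun j => ?_) n
  simp only [gridSum_eq_fst]
  exact (martingale_sum_filter hξ hind hint hmean Prod.fst _).submartingale_abs

/-- The weak-type maximal inequality for two-parameter sums of independent centred variables. -/
theorem mul_measure_le_runMax_gridSum_le (hξ : ∀ k, Measurable (ξ k)) (hind : iIndepFun ξ P)
    (hint : ∀ k, Integrable (ξ k) P) (hmean : ∀ k, ∫ ω, ξ k ω ∂P = 0) (T : Finset (ℕ × ℕ))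
    (m n : ℕ) {t : ℝ} (ht : 0 < t) :
    ENNReal.ofReal t *
        P {ω | t ≤ runMax (fun i => runMax (fun j ω => |gridSum ξ T i j ω|) n) m ω} ≤
      6 * ∫⁻ ω, ENNReal.ofReal |gridSum ξ T m n ω| ∂P := by
  -- Doob's weak inequality in `i` bounds the left side by the expectation of `max_j |S m j|`, to
  -- which the Ottaviani bound in `j` applies.
  refine ((submartingale_runMax_gridSum hξ hind hint hmean T n).maximal_ineq_runMax
    (fun i ω => runMax_nonneg (fun _ _ => abs_nonneg _) n ω) m ht).trans ?_
  refine (setLIntegral_le_lintegral _ _).trans ?_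
  simp only [gridSum_eq_snd]
  exact lintegral_runMax_abs_sum_filter_le hξ hind hint hmean Prod.snd _ n

/-- **Cairoli's inequality** for two-parameter sums of independent centred variables. -/
theorem lintegral_runMax_gridSum_rpow_le (hξ : ∀ k, Measurable (ξ k)) (hind : iIndepFun ξ P)
    (hint : ∀ k, Integrable (ξ k) P) (hmean : ∀ k, ∫ ω, ξ k ω ∂P = 0) (T : Finset (ℕ × ℕ))
    (m n : ℕ) {p : ℝ} (hp : 1 < p)
    (hfin : ∀ i j, ∫⁻ ω, ENNReal.ofReal (|gridSum ξ T i j ω| ^ p) ∂P ≠ ∞) :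
    ∫⁻ ω, ENNReal.ofReal
        (runMax (fun i => runMax (fun j ω => |gridSum ξ T i j ω|) n) m ω ^ p) ∂P ≤
      ENNReal.ofReal ((p / (p - 1)) ^ (2 * p)) *
        ∫⁻ ω, ENNReal.ofReal (|gridSum ξ T m n ω| ^ p) ∂P := by
  have hmeas (i j : ℕ) : Measurable fun ω => |gridSum ξ T i j ω| := by
    simp only [gridSum, Finset.sum_apply]
    exact (Finset.measurable_sum _ fun k _ => hξ k).norm
  have hp' : 0 ≤ p / (p - 1) := div_nonneg (by linarith) (by linarith)
  have h1 := (submartingale_runMax_gridSum hξ hind hint hmean T n).lintegral_runMax_rpow_le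
    (fun i ω => runMax_nonneg (fun _ _ => abs_nonneg _) n ω) m hp
    fun i _ => lintegral_runMax_rpow_ne_top (hmeas i) n fun j _ => hfin i j
  have h2 : ∫⁻ ω, ENNReal.ofReal (runMax (fun j ω => |gridSum ξ T m j ω|) n ω ^ p) ∂P ≤
      ENNReal.ofReal ((p / (p - 1)) ^ p) *
        ∫⁻ ω, ENNReal.ofReal (|gridSum ξ T m n ω| ^ p) ∂P := by
    have hs : Submartingale (fun j ω => |gridSum ξ T m j ω|)
        (gradedFiltration ξ hξ Prod.snd) P := by
      simp only [gridSum_eq_snd]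
      exact (martingale_sum_filter hξ hind hint hmean Prod.snd _).submartingale_abs
    exact hs.lintegral_runMax_rpow_le (fun _ _ => abs_nonneg _) n hp fun j _ => hfin m j
  calc _ ≤ _ := h1
    _ ≤ ENNReal.ofReal ((p / (p - 1)) ^ p) * (ENNReal.ofReal ((p / (p - 1)) ^ p) *
        ∫⁻ ω, ENNReal.ofReal (|gridSum ξ T m n ω| ^ p) ∂P) := by gcongr
    _ = _ := by
      rw [← mul_assoc, ← ENNReal.ofReal_mul (by positivity),
        ← Real.rpow_add' hp' (by linarith), two_mul]

end Grid

/-! ### Finite additivity and continuity from above of a Lévy basis -/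

namespace IsLevyBasis

variable {Ω : Type*} [MeasurableSpace Ω] {P : Measure Ω} {Λ : Set (ℝ≥0 × ℝ) → Ω → ℝ}

theorem ae_empty (hΛ : IsLevyBasis Λ P) : ∀ᵐ ω ∂P, Λ ∅ ω = 0 := by
  have h := hΛ.sigma_additive (fun _ => ∅) (fun _ => MeasurableSet.empty) (by simp)
    (fun i j _ => by simp [Function.onFun])
  filter_upwards [h] with ω hω
  -- Consecutive partial sums of the convergent constant series differ by `Λ ∅`, so this constant
  -- tends to zero.
  have h1 := ((tendsto_add_atTop_iff_nat 1).2 hω).sub hω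
  simp only [Finset.sum_range_succ, add_sub_cancel_left, sub_self] at h1
  exact tendsto_nhds_unique tendsto_const_nhds h1

theorem ae_union (hΛ : IsLevyBasis Λ P) {A B : Set (ℝ≥0 × ℝ)} (hA : MeasurableSet A)
    (hB : MeasurableSet B) (hA' : Bornology.IsBounded A) (hB' : Bornology.IsBounded B)
    (hAB : Disjoint A B) : ∀ᵐ ω ∂P, Λ (A ∪ B) ω = Λ A ω + Λ B ω := by
  set S : ℕ → Set (ℝ≥0 × ℝ) := fun n => if n = 0 then A else if n = 1 then B else ∅ with hS
  have hU : ⋃ n, S n = A ∪ B := by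
    ext z
    simp only [hS, Set.mem_iUnion, Set.mem_union]
    constructor
    · rintro ⟨n, hn⟩
      split_ifs at hn
      exacts [Or.inl hn, Or.inr hn, absurd hn (Set.notMem_empty z)]
    · rintro (h | h)
      exacts [⟨0, by simpa using h⟩, ⟨1, by simpa using h⟩]
  have h := hΛ.sigma_additive S
    (fun n => by simp only [hS]; split_ifs <;> simp [hA, hB])
    (by rw [hU]; exact hA'.union hB')
    (fun i j hij => by
      simp only [Function.onFun, hS]
      split_ifs <;> simp_all [hAB.symm])
  filter_upwards [h, hΛ.ae_empty] with ω hω h0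
  rw [hU] at hω
  refine tendsto_nhds_unique hω (tendsto_const_nhds.congr' ?_)
  filter_upwards [eventually_ge_atTop 2] with N hN
  obtain ⟨k, rfl⟩ := Nat.exists_eq_add_of_le' hN
  induction k with
  | zero => simp [Finset.sum_range_succ, hS]
  | succ k ih =>
    rw [show k + 1 + 2 = (k + 2) + 1 by ring, Finset.sum_range_succ, ← ih (by omega)]
    simp [hS, h0]

theorem ae_biUnion_finset (hΛ : IsLevyBasis Λ P) {ι : Type*} (s : Finset ι)
    {A : ι → Set (ℝ≥0 × ℝ)} (hA : ∀ k, MeasurableSet (A k))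
    (hA' : ∀ k, Bornology.IsBounded (A k)) (hd : Pairwise (Function.onFun Disjoint A)) :
    ∀ᵐ ω ∂P, Λ (⋃ k ∈ s, A k) ω = (∑ k ∈ s, Λ (A k)) ω := by
  classical
  induction s using Finset.induction_on with
  | empty => simpa using hΛ.ae_empty
  | insert a s ha ih =>
    have hu := hΛ.ae_union (hA a) (s.measurableSet_biUnion fun k _ => hA k) (hA' a)
      ((Bornology.isBounded_biUnion_finset s).2 fun k _ => hA' k)
      (Set.disjoint_iUnion₂_right.2 fun k hk => hd (ne_of_mem_of_not_mem hk ha).symm)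
    filter_upwards [ih, hu] with ω h1 h2
    rw [Finset.set_biUnion_insert, h2, h1, Finset.sum_insert ha, Pi.add_apply]

/-- Continuity of `Λ` along decreasing sequences of bounded sets. -/
theorem ae_tendsto_iInter (hΛ : IsLevyBasis Λ P) {A : ℕ → Set (ℝ≥0 × ℝ)}
    (hA : ∀ n, MeasurableSet (A n)) (hA' : ∀ n, Bornology.IsBounded (A n)) (hanti : Antitone A) :
    ∀ᵐ ω ∂P, Tendsto (fun n => Λ (A n) ω) atTop (𝓝 (Λ (⋂ n, A n) ω)) := by
  have hI : MeasurableSet (⋂ n, A n) := MeasurableSet.iInter hA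
  have hsub (n : ℕ) : ⋂ n, A n ⊆ A n := Set.iInter_subset A n
  have hUn : ⋃ n, A n \ A (n + 1) = A 0 \ ⋂ n, A n := by
    ext z
    simp only [Set.mem_iUnion, Set.mem_sdiff, Set.mem_iInter, not_forall]
    constructor
    · rintro ⟨n, h1, h2⟩
      exact ⟨hanti (Nat.zero_le n) h1, n + 1, h2⟩
    · rintro ⟨h0, hex⟩
      classical
      have hpos : Nat.find hex ≠ 0 := fun h => Nat.find_spec hex (h ▸ h0)
      obtain ⟨k, hk⟩ := Nat.exists_eq_succ_of_ne_zero hpos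
      refine ⟨k, not_not.1 (Nat.find_min hex (by omega)), ?_⟩
      have := Nat.find_spec hex
      rwa [hk] at this
  have hdisj : Pairwise (Function.onFun Disjoint fun n => A n \ A (n + 1)) := by
    intro i j hij
    refine Set.disjoint_left.2 fun z h1 h2 => ?_
    rcases lt_or_gt_of_ne hij with h | h
    · exact h1.2 (hanti (Nat.succ_le_of_lt h) h2.1)
    · exact h2.2 (hanti (Nat.succ_le_of_lt h) h1.1)
  have h1 := hΛ.sigma_additive (fun n => A n \ A (n + 1)) (fun n => (hA n).diff (hA _))
    (by rw [hUn]; exact (hA' 0).subset Set.sdiff_subset) hdisj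
  have h2 := hΛ.ae_union hI ((hA 0).diff hI) ((hA' 0).subset (hsub 0))
    ((hA' 0).subset Set.sdiff_subset) Set.disjoint_sdiff_right
  have h3 : ∀ᵐ ω ∂P, ∀ n, Λ (A n) ω = Λ (A (n + 1)) ω + Λ (A n \ A (n + 1)) ω := by
    rw [ae_all_iff]
    intro n
    have := hΛ.ae_union (hA (n + 1)) ((hA n).diff (hA (n + 1))) (hA' _)
      ((hA' n).subset Set.sdiff_subset) Set.disjoint_sdiff_right
    rwa [Set.union_sdiff_cancel (hanti (Nat.le_succ n))] at this
  rw [Set.union_sdiff_cancel (hsub 0)] at h2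
  filter_upwards [h1, h2, h3] with ω h1 h2 h3
  rw [hUn] at h1
  -- The series over the successive differences telescopes, so its convergence is the convergence of
  -- `Λ (A N)`.
  have e (N : ℕ) : ∑ n ∈ Finset.range N, Λ (A n \ A (n + 1)) ω = Λ (A 0) ω - Λ (A N) ω := by
    rw [← Finset.sum_range_sub' (fun n => Λ (A n) ω)]
    exact Finset.sum_congr rfl fun n _ => by rw [h3 n]; ring
  simp only [e] at h1
  have h4 := (tendsto_const_nhds (x := Λ (A 0) ω)).sub h1
  simp only [sub_sub_cancel] at h4
  rwa [h2, add_sub_cancel_right] at h4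

end IsLevyBasis

/-! ### Light-ray coordinates and the grid -/

/-- The light-ray coordinate `c t + x`. -/
def rightCoord (c : ℝ) (r : ℝ≥0 × ℝ) : ℝ := c * r.1 + r.2

/-- The light-ray coordinate `c t - x`. -/
def leftCoord (c : ℝ) (r : ℝ≥0 × ℝ) : ℝ := c * r.1 - r.2

theorem measurable_rightCoord (c : ℝ) : Measurable (rightCoord c) := by
  unfold rightCoord; fun_prop

theorem measurable_leftCoord (c : ℝ) : Measurable (leftCoord c) := by
  unfold leftCoord; fun_prop

theorem mem_backwardCone_iff {c : ℝ} (hc : 0 < c) {r s : ℝ≥0 × ℝ} :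
    s ∈ backwardCone c r ↔ rightCoord c s ≤ rightCoord c r ∧ leftCoord c s ≤ leftCoord c r := by
  change (0 ≤ (r.1 : ℝ) - (s.1 : ℝ) ∧ |r.2 - s.2| ≤ c * ((r.1 : ℝ) - (s.1 : ℝ))) ↔ _
  rw [abs_le, rightCoord, rightCoord, leftCoord, leftCoord]
  constructor
  · rintro ⟨-, h1, h2⟩
    constructor <;> linarith
  · rintro ⟨h1, h2⟩
    refine ⟨?_, by linarith, by linarith⟩
    -- The sum of the two coordinate inequalities already contains the time order, because `c > 0`.
    have : 0 ≤ c * ((r.1 : ℝ) - (s.1 : ℝ)) := by linarith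
    exact nonneg_of_mul_nonneg_right this hc

theorem coneLE_iff {c : ℝ} (hc : 0 < c) {r s : ℝ≥0 × ℝ} :
    ConeLE c s r ↔ rightCoord c s ≤ rightCoord c r ∧ leftCoord c s ≤ leftCoord c r := by
  rw [← mem_backwardCone_iff hc]
  change _ ↔ 0 ≤ (r.1 : ℝ) - (s.1 : ℝ) ∧ |r.2 - s.2| ≤ c * ((r.1 : ℝ) - (s.1 : ℝ))
  rw [ConeLE, sub_nonneg, NNReal.coe_le_coe]

/-- Adding the two inequalities bounds the time from above, and nonnegativity of the time then
confines the position to `[-b, a]`. -/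
theorem isBounded_coord_le {c : ℝ} (hc : 0 < c) (a b : ℝ) :
    Bornology.IsBounded {s | rightCoord c s ≤ a ∧ leftCoord c s ≤ b} := by
  refine ((Metric.isBounded_Icc (0 : ℝ≥0) (((a + b) / (2 * c)).toNNReal)).prod
    (Metric.isBounded_Icc (-b) a)).subset ?_
  rintro ⟨s, y⟩ ⟨h1, h2⟩
  simp only [rightCoord, leftCoord] at h1 h2
  have h3 : 0 ≤ c * (s : ℝ) := by positivity
  refine ⟨⟨zero_le, ?_⟩, by change -b ≤ y; linarith, by change y ≤ a; linarith⟩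
  refine NNReal.le_toNNReal_of_coe_le ?_
  rw [le_div_iff₀ (by positivity)]
  change (s : ℝ) * (2 * c) ≤ a + b
  linarith

theorem measurableSet_backwardCone {c : ℝ} (hc : 0 < c) (r : ℝ≥0 × ℝ) :
    MeasurableSet (backwardCone c r) := by
  have : backwardCone c r =
      {s | rightCoord c s ≤ rightCoord c r} ∩ {s | leftCoord c s ≤ leftCoord c r} := by
    ext s; exact mem_backwardCone_iff hc
  rw [this]
  exact (measurableSet_le (measurable_rightCoord c) measurable_const).inter
    (measurableSet_le (measurable_leftCoord c) measurable_const)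

theorem isBounded_backwardCone {c : ℝ} (hc : 0 < c) (r : ℝ≥0 × ℝ) :
    Bornology.IsBounded (backwardCone c r) :=
  (isBounded_coord_le hc (rightCoord c r) (leftCoord c r)).subset
    fun _ hs => (mem_backwardCone_iff hc).1 hs

/-- The cells of the grid in light-ray coordinates determined by two increasing sequences. -/
def gridCell (c : ℝ) (u v : ℕ → ℝ) (k : ℕ × ℕ) : Set (ℝ≥0 × ℝ) :=
  rightCoord c ⁻¹' disjointed (fun i => Set.Iic (u i)) k.1 ∩
    leftCoord c ⁻¹' disjointed (fun j => Set.Iic (v j)) k.2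

theorem measurableSet_gridCell (c : ℝ) (u v : ℕ → ℝ) (k : ℕ × ℕ) :
    MeasurableSet (gridCell c u v k) :=
  (measurable_rightCoord c (MeasurableSet.disjointed (fun _ => measurableSet_Iic) _)).inter
    (measurable_leftCoord c (MeasurableSet.disjointed (fun _ => measurableSet_Iic) _))

theorem isBounded_gridCell {c : ℝ} (hc : 0 < c) (u v : ℕ → ℝ) (k : ℕ × ℕ) :
    Bornology.IsBounded (gridCell c u v k) :=
  (isBounded_coord_le hc (u k.1) (v k.2)).subset fun _ hs =>
    ⟨disjointed_subset (fun i => Set.Iic (u i)) k.1 hs.1,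
      disjointed_subset (fun i => Set.Iic (v i)) k.2 hs.2⟩

theorem pairwise_disjoint_gridCell (c : ℝ) (u v : ℕ → ℝ) :
    Pairwise (Function.onFun Disjoint (gridCell c u v)) := by
  intro k l hkl
  refine Set.disjoint_left.2 fun s hs hs' => hkl ?_
  by_contra
  rcases not_and_or.1 (mt Prod.ext_iff.2 hkl) with h | h
  · exact Set.disjoint_left.1 (disjoint_disjointed (fun i => Set.Iic (u i)) h) hs.1 hs'.1
  · exact Set.disjoint_left.1 (disjoint_disjointed (fun i => Set.Iic (v i)) h) hs.2 hs'.2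

theorem exists_mem_disjointed_Iic {u : ℕ → ℝ} {a : ℝ} {i : ℕ} (h : a ≤ u i) :
    ∃ k ≤ i, a ∈ disjointed (fun i => Set.Iic (u i)) k := by
  have : a ∈ ⋃ k ∈ Finset.Iic i, disjointed (fun i => Set.Iic (u i)) k := by
    rw [biUnion_Iic_disjointed]
    exact le_partialSups (fun i => Set.Iic (u i)) i h
  simpa using this

/-- The cells of index zero in either direction are not bounded below in that coordinate, so the
union of the cells up to `(i, j)` is a full quadrant. -/
theorem biUnion_gridCell_eq {c : ℝ} {u v : ℕ → ℝ} (hu : Monotone u) (hv : Monotone v)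
    {m n i j : ℕ} (hi : i ≤ m) (hj : j ≤ n) :
    ⋃ k ∈ (Finset.range (m + 1) ×ˢ Finset.range (n + 1)).filter
      (fun k => k.1 ≤ i ∧ k.2 ≤ j), gridCell c u v k =
    {s | rightCoord c s ≤ u i ∧ leftCoord c s ≤ v j} := by
  ext s
  simp only [Set.mem_iUnion, Finset.mem_filter, Finset.mem_product, Finset.mem_range,
    exists_prop]
  constructor
  · rintro ⟨k, ⟨-, h1, h2⟩, hs⟩
    exact ⟨(disjointed_subset (fun i => Set.Iic (u i)) k.1 hs.1).trans (hu h1),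
      (disjointed_subset (fun i => Set.Iic (v i)) k.2 hs.2).trans (hv h2)⟩
  · rintro ⟨h1, h2⟩
    obtain ⟨k, hk, hk'⟩ := exists_mem_disjointed_Iic h1
    obtain ⟨l, hl, hl'⟩ := exists_mem_disjointed_Iic h2
    exact ⟨(k, l), ⟨⟨by simp; omega, by simp; omega⟩, hk, hl⟩, hk', hl'⟩

/-- Supplies grid lines through the coordinates of all cones, the last one belonging to `q`.
Induction removes the largest element `a`: a sequence for the rest that ends at `a` is continued by
the value `b`. -/
theorem exists_monotone_seq_of_finset (T : Finset ℝ) (b : ℝ) (hT : ∀ t ∈ T, t ≤ b) :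
    ∃ (u : ℕ → ℝ) (n : ℕ), Monotone u ∧ u n = b ∧ ∀ t ∈ T, ∃ i ≤ n, u i = t := by
  induction T using Finset.induction_on_max generalizing b with
  | empty => exact ⟨fun _ => b, 0, monotone_const, rfl, by simp⟩
  | insert a s hs ih =>
    obtain ⟨u, n, hu, hun, hex⟩ := ih a fun t ht => (hs t ht).le
    have hab : a ≤ b := hT a (Finset.mem_insert_self a s)
    refine ⟨fun i => if i ≤ n then u i else b, n + 1, monotone_nat_of_le_succ fun i => ?_,
      by simp, fun t ht => ?_⟩
    · rcases lt_trichotomy i n with h | h | h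
      · simpa [h.le, Nat.succ_le_of_lt h] using hu (Nat.le_succ i)
      · simp [h, hun, hab]
      · simp [not_le.2 h, show ¬ (i + 1 ≤ n) by omega]
    · rcases Finset.mem_insert.1 ht with rfl | ht
      · exact ⟨n, Nat.le_succ n, by simp [hun]⟩
      · obtain ⟨i, hi, h⟩ := hex t ht
        exact ⟨i, hi.trans (Nat.le_succ n), by simp [hi, h]⟩

theorem le_runMax_runMax {Ω : Type*} (f : ℕ → ℕ → Ω → ℝ) {i j m n : ℕ} (hi : i ≤ m) (hj : j ≤ n)
    (ω : Ω) : f i j ω ≤ runMax (fun i => runMax (f i) n) m ω :=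
  (le_runMax (f i) hj ω).trans (le_runMax (fun i => runMax (f i) n) hi ω)

/-! ### Maximal inequalities over finite and countable families of cones -/

section MaximalInequality

variable {Ω : Type*} [MeasurableSpace Ω] {P : Measure Ω}
  {Λ : Set (ℝ≥0 × ℝ) → Ω → ℝ} {c : ℝ}

/-- The values of a Lévy basis on finitely many backward cones below `q` are two-parameter partial
sums of independent variables. -/
theorem IsLevyBasis.exists_gridSum (hΛ : IsLevyBasis Λ P) (hc : 0 < c) {q : ℝ≥0 × ℝ}
    (F : Finset (ℝ≥0 × ℝ)) (hF : ∀ r ∈ F, ConeLE c r q) :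
    ∃ (A : ℕ × ℕ → Set (ℝ≥0 × ℝ)) (T : Finset (ℕ × ℕ)) (m n : ℕ),
      (∀ k, MeasurableSet (A k)) ∧ (∀ k, Bornology.IsBounded (A k)) ∧
      Pairwise (Function.onFun Disjoint A) ∧
      (gridSum (fun k => Λ (A k)) T m n =ᵐ[P] Λ (backwardCone c q)) ∧
      ∀ r ∈ F, ∃ i ≤ m, ∃ j ≤ n,
        gridSum (fun k => Λ (A k)) T i j =ᵐ[P] Λ (backwardCone c r) := by
  classical
  obtain ⟨u, m, hu, hum, hFu⟩ := exists_monotone_seq_of_finset (F.image (rightCoord c))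
    (rightCoord c q) (by
      simp only [Finset.mem_image, forall_exists_index, and_imp, forall_apply_eq_imp_iff₂]
      exact fun r hr => ((coneLE_iff hc).1 (hF r hr)).1)
  obtain ⟨v, n, hv, hvn, hFv⟩ := exists_monotone_seq_of_finset (F.image (leftCoord c))
    (leftCoord c q) (by
      simp only [Finset.mem_image, forall_exists_index, and_imp, forall_apply_eq_imp_iff₂]
      exact fun r hr => ((coneLE_iff hc).1 (hF r hr)).2)
  have key (r : ℝ≥0 × ℝ) (i j : ℕ) (hi : i ≤ m) (hj : j ≤ n) (hri : u i = rightCoord c r)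
      (hrj : v j = leftCoord c r) :
      gridSum (fun k => Λ (gridCell c u v k)) (Finset.range (m + 1) ×ˢ Finset.range (n + 1)) i j
        =ᵐ[P] Λ (backwardCone c r) := by
    have h := hΛ.ae_biUnion_finset ((Finset.range (m + 1) ×ˢ Finset.range (n + 1)).filter
      (fun k => k.1 ≤ i ∧ k.2 ≤ j)) (measurableSet_gridCell c u v) (isBounded_gridCell hc u v)
      (pairwise_disjoint_gridCell c u v)
    have e : {s | rightCoord c s ≤ u i ∧ leftCoord c s ≤ v j} = backwardCone c r := by
      ext s
      rw [mem_backwardCone_iff hc, hri, hrj]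
      rfl
    rw [biUnion_gridCell_eq hu hv hi hj, e] at h
    filter_upwards [h] with ω hω
    exact hω.symm
  refine ⟨gridCell c u v, _, m, n, measurableSet_gridCell c u v, isBounded_gridCell hc u v,
    pairwise_disjoint_gridCell c u v, key q m n le_rfl le_rfl hum hvn, fun r hr => ?_⟩
  obtain ⟨i, hi, hi'⟩ := hFu _ (Finset.mem_image_of_mem _ hr)
  obtain ⟨j, hj, hj'⟩ := hFv _ (Finset.mem_image_of_mem _ hr)
  exact ⟨i, hi, j, hj, key r i j hi hj hi' hj'⟩

theorem IsLevyBasis.iIndepFun_prod (hΛ : IsLevyBasis Λ P) {A : ℕ × ℕ → Set (ℝ≥0 × ℝ)}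
    (hA : ∀ k, MeasurableSet (A k)) (hA' : ∀ k, Bornology.IsBounded (A k))
    (hd : Pairwise (Function.onFun Disjoint A)) : iIndepFun (fun k => Λ (A k)) P := by
  have h := hΛ.indep (fun n => A (Nat.pairEquiv.symm n)) (fun _ => hA _) (fun _ => hA' _)
    fun i j hij => hd (Nat.pairEquiv.symm.injective.ne hij)
  have h' := h.precomp Nat.pairEquiv.injective
  simpa only [Function.comp_def, Equiv.symm_apply_apply] using h'

variable [IsProbabilityMeasure P]

/-- Weak-type maximal inequality over finitely many cones. -/
theorem IsLevyBasis.mul_measure_finset_le (hΛ : IsLevyBasis Λ P) (hmean : HasMeanZero Λ P)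
    (hc : 0 < c) {q : ℝ≥0 × ℝ} (F : Finset (ℝ≥0 × ℝ)) (hF : ∀ r ∈ F, ConeLE c r q) {l : ℝ}
    (hl : 0 < l) :
    ENNReal.ofReal l * P {ω | ∃ r ∈ F, l ≤ |Λ (backwardCone c r) ω|} ≤
      6 * ∫⁻ ω, ‖Λ (backwardCone c q) ω‖ₑ ∂P := by
  obtain ⟨A, T, m, n, hA, hA', hd, hq, hr⟩ := hΛ.exists_gridSum hc F hF
  have h := mul_measure_le_runMax_gridSum_le (fun k => hΛ.measurable _ (hA k) (hA' k))
    (hΛ.iIndepFun_prod hA hA' hd) (fun k => (hmean _ (hA k) (hA' k)).1)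
    (fun k => (hmean _ (hA k) (hA' k)).2) T m n hl
  have e : ∫⁻ ω, ENNReal.ofReal |gridSum (fun k => Λ (A k)) T m n ω| ∂P =
      ∫⁻ ω, ‖Λ (backwardCone c q) ω‖ₑ ∂P := by
    refine lintegral_congr_ae ?_
    filter_upwards [hq] with ω hω
    rw [hω, Real.enorm_eq_ofReal_abs]
  rw [e] at h
  refine le_trans ?_ h
  gcongr 1
  refine measure_mono_ae ?_
  choose! i hi j hj hij using hr
  have hall := (ae_ball_iff F.countable_toSet).2 hij
  filter_upwards [hall] with ω hω
  rintro ⟨r, hrF, hlr⟩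
  rw [← hω r hrF] at hlr
  exact hlr.trans (le_runMax_runMax (fun i j ω => |gridSum (fun k => Λ (A k)) T i j ω|)
    (hi r hrF) (hj r hrF) ω)

/-- `L^a` maximal inequality over finitely many cones. -/
theorem IsLevyBasis.lintegral_sup_finset_le (hΛ : IsLevyBasis Λ P) (hmean : HasMeanZero Λ P)
    (hc : 0 < c) {q : ℝ≥0 × ℝ} (F : Finset (ℝ≥0 × ℝ)) (hF : ∀ r ∈ F, ConeLE c r q) {a : ℝ}
    (ha : 1 < a) (hmom : HasFiniteMoment Λ P a) :
    ∫⁻ ω, F.sup (fun r => ‖Λ (backwardCone c r) ω‖ₑ ^ a) ∂P ≤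
      ENNReal.ofReal ((a / (a - 1)) ^ (2 * a)) * ∫⁻ ω, ‖Λ (backwardCone c q) ω‖ₑ ^ a ∂P := by
  have ha0 : 0 ≤ a := by linarith
  have he (x : ℝ) : ‖x‖ₑ ^ a = ENNReal.ofReal (|x| ^ a) := by
    rw [Real.enorm_eq_ofReal_abs, ENNReal.ofReal_rpow_of_nonneg (abs_nonneg x) ha0]
  obtain ⟨A, T, m, n, hA, hA', hd, hq, hr⟩ := hΛ.exists_gridSum hc F hF
  have h := lintegral_runMax_gridSum_rpow_le (fun k => hΛ.measurable _ (hA k) (hA' k))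
    (hΛ.iIndepFun_prod hA hA' hd) (fun k => (hmean _ (hA k) (hA' k)).1)
    (fun k => (hmean _ (hA k) (hA' k)).2) T m n ha (fun i j => by
      -- Each partial sum is almost surely the value of `Λ` on one bounded set, hence has a finite
      -- moment.
      set s := T.filter fun k => k.1 ≤ i ∧ k.2 ≤ j with hs
      have h1 := hΛ.ae_biUnion_finset s hA hA' hd
      have h2 := (hmom (⋃ k ∈ s, A k) (s.measurableSet_biUnion fun k _ => hA k)
        ((Bornology.isBounded_biUnion_finset s).2 fun k _ => hA' k)).lintegral_lt_top
      refine ne_top_of_le_ne_top h2.ne (lintegral_mono_ae ?_)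
      filter_upwards [h1] with ω hω
      rw [hω, gridSum])
  have e : ∫⁻ ω, ENNReal.ofReal (|gridSum (fun k => Λ (A k)) T m n ω| ^ a) ∂P =
      ∫⁻ ω, ‖Λ (backwardCone c q) ω‖ₑ ^ a ∂P := by
    refine lintegral_congr_ae ?_
    filter_upwards [hq] with ω hω
    rw [hω, he]
  rw [e] at h
  refine le_trans (lintegral_mono_ae ?_) h
  choose! i hi j hj hij using hr
  have hall := (ae_ball_iff F.countable_toSet).2 hij
  filter_upwards [hall] with ω hω
  refine Finset.sup_le fun r hrF => ?_
  rw [he, ← hω r hrF]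
  refine ENNReal.ofReal_le_ofReal (Real.rpow_le_rpow (abs_nonneg _) ?_ ha0)
  exact le_runMax_runMax (fun i j ω => |gridSum (fun k => Λ (A k)) T i j ω|)
    (hi r hrF) (hj r hrF) ω

/-- Weak-type maximal inequality over a sequence of cones. -/
theorem IsLevyBasis.mul_measure_iSup_le (hΛ : IsLevyBasis Λ P) (hmean : HasMeanZero Λ P)
    (hc : 0 < c) {q : ℝ≥0 × ℝ} (d : ℕ → ℝ≥0 × ℝ) (hd : ∀ n, ConeLE c (d n) q) {l : ℝ}
    (hl : 0 < l) :
    ENNReal.ofReal l * P {ω | ENNReal.ofReal l ≤ ⨆ n, ‖Λ (backwardCone c (d n)) ω‖ₑ} ≤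
      6 * ∫⁻ ω, ‖Λ (backwardCone c q) ω‖ₑ ∂P := by
  classical
  set K := 6 * ∫⁻ ω, ‖Λ (backwardCone c q) ω‖ₑ ∂P with hK
  -- A supremum that is at least `l` need not be attained, whereas one strictly above `x` is
  -- witnessed by some finite stage. The bound at level `l` follows by letting `x` increase to `l`.
  have hstrict (x : ℝ) (hx : 0 < x) :
      ENNReal.ofReal x * P {ω | ENNReal.ofReal x < ⨆ n, ‖Λ (backwardCone c (d n)) ω‖ₑ} ≤ K := by
    set S : ℕ → Set Ω := fun N =>
      {ω | ∃ r ∈ (Finset.range N).image d, x ≤ |Λ (backwardCone c r) ω|} with hS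
    have hmono : Monotone S := fun M N hMN ω ⟨r, hr, h⟩ =>
      ⟨r, Finset.image_subset_image (Finset.range_mono hMN) hr, h⟩
    calc ENNReal.ofReal x * P {ω | ENNReal.ofReal x < ⨆ n, ‖Λ (backwardCone c (d n)) ω‖ₑ}
        ≤ ENNReal.ofReal x * P (⋃ N, S N) := by
          gcongr
          intro ω hω
          obtain ⟨n, hn⟩ := lt_iSup_iff.1 (Set.mem_ofPred_eq ▸ hω)
          refine Set.mem_iUnion.2 ⟨n + 1, d n,
            Finset.mem_image_of_mem d (Finset.self_mem_range_succ n), ?_⟩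
          rw [Real.enorm_eq_ofReal_abs] at hn
          exact (ENNReal.ofReal_le_ofReal_iff (abs_nonneg _)).1 hn.le
      _ = ⨆ N, ENNReal.ofReal x * P (S N) := by
          rw [hmono.measure_iUnion, ENNReal.mul_iSup]
      _ ≤ K := by
          refine iSup_le fun N => hΛ.mul_measure_finset_le hmean hc _ (fun r hr => ?_) hx
          obtain ⟨n, -, rfl⟩ := Finset.mem_image.1 hr
          exact hd n
  set p₀ := P {ω | ENNReal.ofReal l ≤ ⨆ n, ‖Λ (backwardCone c (d n)) ω‖ₑ} with hp₀
  have hlim : Tendsto (fun x : ℝ => ENNReal.ofReal x * p₀) (𝓝[<] l)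
      (𝓝 (ENNReal.ofReal l * p₀)) := by
    refine ENNReal.Tendsto.mul_const ?_ (Or.inr (measure_ne_top P _))
    exact (ENNReal.continuous_ofReal.tendsto l).mono_left nhdsWithin_le_nhds
  refine le_of_tendsto hlim ?_
  filter_upwards [Ioo_mem_nhdsLT hl] with x hx
  refine le_trans ?_ (hstrict x hx.1)
  gcongr
  rw [hp₀]
  refine measure_mono fun ω hω => ?_
  exact lt_of_lt_of_le ((ENNReal.ofReal_lt_ofReal_iff hl).2 hx.2) hω

/-- `L^a` maximal inequality over a sequence of cones. -/
theorem IsLevyBasis.lintegral_iSup_le (hΛ : IsLevyBasis Λ P) (hmean : HasMeanZero Λ P)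
    (hc : 0 < c) {q : ℝ≥0 × ℝ} (d : ℕ → ℝ≥0 × ℝ) (hd : ∀ n, ConeLE c (d n) q) {a : ℝ}
    (ha : 1 < a) (hmom : HasFiniteMoment Λ P a) :
    ∫⁻ ω, (⨆ n, ‖Λ (backwardCone c (d n)) ω‖ₑ ^ a) ∂P ≤
      ENNReal.ofReal ((a / (a - 1)) ^ (2 * a)) * ∫⁻ ω, ‖Λ (backwardCone c q) ω‖ₑ ^ a ∂P := by
  classical
  set f : ℕ → Ω → ℝ≥0∞ := fun N ω =>
    ((Finset.range N).image d).sup fun r => ‖Λ (backwardCone c r) ω‖ₑ ^ a with hf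
  have hmeas (r : ℝ≥0 × ℝ) : Measurable (Λ (backwardCone c r)) :=
    hΛ.measurable _ (measurableSet_backwardCone hc r) (isBounded_backwardCone hc r)
  have hfm (N : ℕ) : Measurable (f N) := by
    simp only [hf, Finset.sup_eq_iSup]
    exact Measurable.biSup _ (Finset.countable_toSet _) fun r _ => (hmeas r).enorm.pow_const a
  have hmono : Monotone f := fun M N hMN ω =>
    Finset.sup_mono (Finset.image_subset_image (Finset.range_mono hMN))
  calc ∫⁻ ω, (⨆ n, ‖Λ (backwardCone c (d n)) ω‖ₑ ^ a) ∂P ≤ ∫⁻ ω, (⨆ N, f N ω) ∂P := by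
        refine lintegral_mono fun ω => iSup_le fun n => le_iSup_of_le (n + 1) ?_
        exact Finset.le_sup (f := fun r => ‖Λ (backwardCone c r) ω‖ₑ ^ a)
          (Finset.mem_image_of_mem d (Finset.self_mem_range_succ n))
    _ = ⨆ N, ∫⁻ ω, f N ω ∂P := lintegral_iSup hfm hmono
    _ ≤ _ := by
        refine iSup_le fun N => hΛ.lintegral_sup_finset_le hmean hc _ (fun r hr => ?_) ha hmom
        obtain ⟨n, -, rfl⟩ := Finset.mem_image.1 hr
        exact hd n

end MaximalInequality

/-! ### Countable approximation from above and the separable version -/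

/-- The point of `ℝ₊ × ℝ` with light-ray coordinates `a` and `b`, provided `0 ≤ a + b`. -/
noncomputable def pointOfCoords (c : ℝ) (x : ℝ × ℝ) : ℝ≥0 × ℝ :=
  (((x.1 + x.2) / (2 * c)).toNNReal, (x.1 - x.2) / 2)

theorem continuous_pointOfCoords (c : ℝ) : Continuous (pointOfCoords c) := by
  unfold pointOfCoords
  fun_prop

theorem pointOfCoords_coords {c : ℝ} (hc : 0 < c) (r : ℝ≥0 × ℝ) :
    pointOfCoords c (rightCoord c r, leftCoord c r) = r := by
  ext
  · simp only [pointOfCoords, rightCoord, leftCoord]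
    rw [show (c * (r.1 : ℝ) + r.2 + (c * r.1 - r.2)) / (2 * c) = r.1 by field_simp; ring]
    simp
  · simp only [pointOfCoords, rightCoord, leftCoord]
    ring

theorem rightCoord_pointOfCoords {c : ℝ} (hc : 0 < c) {x : ℝ × ℝ} (hx : 0 ≤ x.1 + x.2) :
    rightCoord c (pointOfCoords c x) = x.1 := by
  simp only [pointOfCoords, rightCoord]
  rw [Real.coe_toNNReal _ (by positivity)]
  field_simp
  ring

theorem leftCoord_pointOfCoords {c : ℝ} (hc : 0 < c) {x : ℝ × ℝ} (hx : 0 ≤ x.1 + x.2) :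
    leftCoord c (pointOfCoords c x) = x.2 := by
  simp only [pointOfCoords, leftCoord]
  rw [Real.coe_toNNReal _ (by positivity)]
  field_simp
  ring

theorem rightCoord_add_leftCoord_nonneg {c : ℝ} (hc : 0 < c) (r : ℝ≥0 × ℝ) :
    0 ≤ rightCoord c r + leftCoord c r := by
  have : 0 ≤ c * (r.1 : ℝ) := by positivity
  simp only [rightCoord, leftCoord]
  linarith

theorem exists_antitone_seq_rat {a b : ℝ} (hab : a ≤ b) :
    ∃ e : ℕ → ℝ, Antitone e ∧ (∀ n, a ≤ e n ∧ e n ≤ b) ∧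
      (∀ n, e n ∈ insert b (Set.range ((↑) : ℚ → ℝ))) ∧ Tendsto e atTop (𝓝 a) := by
  obtain ⟨w, hw, haw, hlim⟩ := Real.exists_seq_rat_strictAnti_tendsto a
  refine ⟨fun n => min (w n : ℝ) b, fun m n hmn => min_le_min_right b ?_,
    fun n => ⟨le_min (haw n).le hab, min_le_right _ _⟩, fun n => ?_, ?_⟩
  · exact_mod_cast hw.antitone hmn
  · rcases min_choice (w n : ℝ) b with h | h
    · exact Or.inr ⟨w n, h.symm⟩
    · exact Or.inl h
  · simpa [min_eq_left hab] using hlim.min (tendsto_const_nhds (x := b))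

/-- The interval `[p, q]` has a countable subset from which each of its points can be reached
along a decreasing sequence of cones. -/
theorem exists_countable_approx {c : ℝ} (hc : 0 < c) (p q : ℝ≥0 × ℝ) :
    ∃ D : Set (ℝ≥0 × ℝ), D.Countable ∧ D ⊆ coneInterval c p q ∧
      ∀ r ∈ coneInterval c p q, ∃ d : ℕ → ℝ≥0 × ℝ, (∀ n, d n ∈ D) ∧ Tendsto d atTop (𝓝 r) ∧
        Antitone (fun n => backwardCone c (d n)) ∧
        ⋂ n, backwardCone c (d n) = backwardCone c r := by
  -- Rational coordinates alone do not suffice: a point sharing a coordinate with `q` can be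
  -- approached from above inside the interval only by keeping that coordinate, so those of `q` are
  -- added.
  refine ⟨pointOfCoords c '' ((insert (rightCoord c q) (Set.range ((↑) : ℚ → ℝ))) ×ˢ
    (insert (leftCoord c q) (Set.range ((↑) : ℚ → ℝ)))) ∩ coneInterval c p q,
    ((((Set.countable_range _).insert _).prod ((Set.countable_range _).insert _)).image _).mono
      Set.inter_subset_left, Set.inter_subset_right, ?_⟩
  rintro r ⟨hpr, hrq⟩
  obtain ⟨hpr1, hpr2⟩ := (coneLE_iff hc).1 hpr
  obtain ⟨hrq1, hrq2⟩ := (coneLE_iff hc).1 hrq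
  obtain ⟨a, ha, hab, haD, halim⟩ := exists_antitone_seq_rat hrq1
  obtain ⟨b, hb, hbb, hbD, hblim⟩ := exists_antitone_seq_rat hrq2
  have hab0 (n : ℕ) : 0 ≤ (a n, b n).1 + (a n, b n).2 := by
    have := rightCoord_add_leftCoord_nonneg hc r
    have h1 := (hab n).1
    have h2 := (hbb n).1
    change 0 ≤ a n + b n
    linarith
  have hR (n : ℕ) : rightCoord c (pointOfCoords c (a n, b n)) = a n :=
    rightCoord_pointOfCoords hc (hab0 n)
  have hL (n : ℕ) : leftCoord c (pointOfCoords c (a n, b n)) = b n :=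
    leftCoord_pointOfCoords hc (hab0 n)
  refine ⟨fun n => pointOfCoords c (a n, b n), fun n => ⟨⟨_, ⟨haD n, hbD n⟩, rfl⟩, ?_, ?_⟩, ?_,
    fun m n hmn s hs => ?_, ?_⟩
  · rw [coneLE_iff hc, hR, hL]
    exact ⟨hpr1.trans (hab n).1, hpr2.trans (hbb n).1⟩
  · rw [coneLE_iff hc, hR, hL]
    exact ⟨(hab n).2, (hbb n).2⟩
  · have := ((continuous_pointOfCoords c).tendsto _).comp (halim.prodMk_nhds hblim)
    rwa [pointOfCoords_coords hc] at this
  · rw [mem_backwardCone_iff hc, hR, hL] at hs ⊢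
    exact ⟨hs.1.trans (ha hmn), hs.2.trans (hb hmn)⟩
  · ext s
    simp only [Set.mem_iInter, mem_backwardCone_iff hc, hR, hL]
    refine ⟨fun h => ⟨ge_of_tendsto' halim fun n => (h n).1, ge_of_tendsto' hblim fun n => (h n).2⟩,
      fun h n => ⟨h.1.trans (hab n).1, h.2.trans (hbb n).1⟩⟩

theorem coneInterval_right_mem {c : ℝ} {p q : ℝ≥0 × ℝ} (hpq : ConeLE c p q) :
    q ∈ coneInterval c p q :=
  ⟨hpq, le_rfl, by simp⟩

/-- Adjoining `q` guarantees a nonempty set, as an enumeration by `ℕ` requires. -/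
theorem exists_seq_range_eq_insert {T : Type*} {D : Set T} (hD : D.Countable) (q : T) :
    ∃ d : ℕ → T, Set.range d = insert q D :=
  let ⟨d, hd⟩ := (hD.insert q).exists_eq_range (Set.insert_nonempty q D)
  ⟨d, hd.symm⟩

section Version

variable {Ω : Type*} [MeasurableSpace Ω] {P : Measure Ω} [IsProbabilityMeasure P]
  {Λ : Set (ℝ≥0 × ℝ) → Ω → ℝ} {c : ℝ}

/-- The weak-type bound at levels `N + 1` has a finite right side independent of `N`, so the event
that the supremum is infinite has probability zero. -/
theorem IsLevyBasis.ae_iSup_lt_top (hΛ : IsLevyBasis Λ P) (hmean : HasMeanZero Λ P)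
    (hc : 0 < c) {q : ℝ≥0 × ℝ} (d : ℕ → ℝ≥0 × ℝ) (hd : ∀ n, ConeLE c (d n) q) :
    ∀ᵐ ω ∂P, ⨆ n, ‖Λ (backwardCone c (d n)) ω‖ₑ ≠ ∞ := by
  have hfin : 6 * ∫⁻ ω, ‖Λ (backwardCone c q) ω‖ₑ ∂P ≠ ∞ :=
    ENNReal.mul_ne_top (by simp) (hmean _ (measurableSet_backwardCone hc q)
      (isBounded_backwardCone hc q)).1.2.ne
  simp only [ae_iff, not_not]
  by_contra h0
  set μ₀ := P {ω | ⨆ n, ‖Λ (backwardCone c (d n)) ω‖ₑ = ∞} with hμ₀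
  have hle (N : ℕ) : ((N + 1 : ℕ) : ℝ≥0∞) * μ₀ ≤ 6 * ∫⁻ ω, ‖Λ (backwardCone c q) ω‖ₑ ∂P := by
    have := hΛ.mul_measure_iSup_le hmean hc d hd (l := (N + 1 : ℕ)) (by positivity)
    rw [ENNReal.ofReal_natCast] at this
    refine le_trans ?_ this
    gcongr
    rw [hμ₀]
    refine measure_mono fun ω hω => ?_
    simp only [Set.mem_ofPred_eq] at hω ⊢
    simp [hω]
  obtain ⟨N, hN⟩ := ENNReal.exists_nat_mul_gt h0 hfin
  refine absurd (hle N) (not_le.2 (hN.trans_le ?_))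
  gcongr
  exact Nat.le_succ N

/-- The process of values on the backward cones has a separable version. -/
theorem IsLevyBasis.exists_isSeparableOn (hΛ : IsLevyBasis Λ P) (hmean : HasMeanZero Λ P)
    (hc : 0 < c) {p q : ℝ≥0 × ℝ} (hpq : ConeLE c p q) :
    ∃ X : ℝ≥0 × ℝ → Ω → ℝ, IsVersion X (fun r => Λ (backwardCone c r)) P ∧
      IsSeparableOn X (coneInterval c p q) P := by
  classical
  obtain ⟨D, hDc, hDI, happ⟩ := exists_countable_approx hc p q
  set I := coneInterval c p q with hI
  set Y : ℝ≥0 × ℝ → Ω → ℝ := fun r => Λ (backwardCone c r) with hY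
  -- `Good r ω z` says that `z` is a limit value at `r` of the path of `Y` along `D`. The version
  -- `X` keeps `Y r ω` where it is good and otherwise takes some good value, if there is one.
  -- Nothing changes on `D`, so limit values along `D` are the same for `X` and `Y`.
  set Good : ℝ≥0 × ℝ → Ω → ℝ → Prop := fun r ω z =>
    ∀ U ∈ 𝓝 r, z ∈ closure ((fun u => Y u ω) '' (D ∩ U)) with hGood
  have hgood_ae (r : ℝ≥0 × ℝ) (hr : r ∈ I) : ∀ᵐ ω ∂P, Good r ω (Y r ω) := by
    obtain ⟨d, hdD, hdr, hanti, hInter⟩ := happ r hr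
    have h := hΛ.ae_tendsto_iInter (fun n => measurableSet_backwardCone hc (d n))
      (fun n => isBounded_backwardCone hc (d n)) hanti
    rw [hInter] at h
    filter_upwards [h] with ω hω U hU
    refine mem_closure_of_tendsto hω ?_
    filter_upwards [hdr hU] with n hn
    exact ⟨d n, ⟨hdD n, hn⟩, rfl⟩
  have hgood_D (r : ℝ≥0 × ℝ) (hr : r ∈ D) (ω : Ω) : Good r ω (Y r ω) := fun U hU =>
    subset_closure ⟨r, ⟨hr, mem_of_mem_nhds hU⟩, rfl⟩
  set X : ℝ≥0 × ℝ → Ω → ℝ := fun r ω =>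
    if Good r ω (Y r ω) then Y r ω else
      if h : r ∈ I ∧ ∃ z, Good r ω z then h.2.choose else Y r ω with hX
  have hXgood (r : ℝ≥0 × ℝ) (ω : Ω) (h : Good r ω (Y r ω)) : X r ω = Y r ω := by
    simp only [hX, if_pos h]
  refine ⟨X, fun r => ?_, D, hDc, hDI, ?_⟩
  · by_cases hr : r ∈ I
    · filter_upwards [hgood_ae r hr] with ω hω using hXgood r ω hω
    · refine Eventually.of_forall fun ω => ?_
      simp [hX, hr, hY]
  · obtain ⟨e, he⟩ := exists_seq_range_eq_insert hDc q
    have heI (n : ℕ) : e n ∈ I := by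
      have : e n ∈ insert q D := he ▸ Set.mem_range_self n
      rcases this with h | h
      · rw [h]; exact coneInterval_right_mem hpq
      · exact hDI h
    filter_upwards [hΛ.ae_iSup_lt_top hmean hc e fun n => (heI n).2] with ω hω r hr
    have himg (U : Set (ℝ≥0 × ℝ)) :
        (fun u => X u ω) '' (D ∩ U) = (fun u => Y u ω) '' (D ∩ U) :=
      Set.image_congr fun u hu => hXgood u ω (hgood_D u hu.1 ω)
    suffices Good r ω (X r ω) by
      intro U hU
      rw [himg]
      exact this U hU
    by_cases hg : Good r ω (Y r ω)
    · rwa [hXgood r ω hg]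
    -- The path is bounded on `D`, so along a sequence in `D` tending to `r` some subsequence of
    -- values converges.
    · have hex : ∃ z, Good r ω z := by
        obtain ⟨d, hdD, hdr, -, -⟩ := happ r hr
        set B := (⨆ n, ‖Λ (backwardCone c (e n)) ω‖ₑ).toReal with hB
        have hbound (n : ℕ) : Y (d n) ω ∈ Set.Icc (-B) B := by
          obtain ⟨k, hk⟩ : d n ∈ Set.range e := he ▸ Or.inr (hdD n)
          have h1 : ‖Y (d n) ω‖ₑ ≤ ⨆ n, ‖Λ (backwardCone c (e n)) ω‖ₑ := by
            rw [← hk]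
            exact le_iSup (fun n => ‖Λ (backwardCone c (e n)) ω‖ₑ) k
          have h2 := ENNReal.toReal_mono hω h1
          rw [toReal_enorm, Real.norm_eq_abs] at h2
          exact abs_le.1 h2
        obtain ⟨z, -, φ, hφ, hz⟩ := isCompact_Icc.tendsto_subseq hbound
        refine ⟨z, fun U hU => mem_closure_of_tendsto hz ?_⟩
        filter_upwards [(hdr.comp hφ.tendsto_atTop) hU] with n hn
        exact ⟨d (φ n), ⟨hdD _, hn⟩, rfl⟩
      have hXe : X r ω = (show r ∈ I ∧ ∃ z, Good r ω z from ⟨hr, hex⟩).2.choose := by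
        simp only [hX, if_neg hg]
        exact dif_pos ⟨hr, hex⟩
      rw [hXe]
      exact Exists.choose_spec _

end Version

/-! ### From countable suprema to the whole interval -/

/-- A supremum over the parameter set of a separable process is a countable supremum. -/
theorem ae_biSup_eq_iSup_of_separable {Ω T : Type*} [MeasurableSpace Ω] [TopologicalSpace T]
    {P : Measure Ω} {X : T → Ω → ℝ} {I D : Set T} (hDI : D ⊆ I)
    (hsep : ∀ᵐ ω ∂P, ∀ r ∈ I, ∀ U ∈ 𝓝 r, X r ω ∈ closure ((fun u => X u ω) '' (D ∩ U)))
    {q : T} (hq : q ∈ I) {d : ℕ → T} (hd : Set.range d = insert q D) {g : ℝ → ℝ≥0∞}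
    (hg : Continuous g) : ∀ᵐ ω ∂P, ⨆ r ∈ I, g (X r ω) = ⨆ n, g (X (d n) ω) := by
  filter_upwards [hsep] with ω hω
  refine le_antisymm (iSup₂_le fun r hr => ?_) (iSup_le fun n => ?_)
  -- This closed sublevel set contains all values on `D`, hence their closure. Only the
  -- neighbourhood `Set.univ` is needed here.
  · have hcl : IsClosed {z | g z ≤ ⨆ n, g (X (d n) ω)} := isClosed_le hg continuous_const
    refine (hcl.closure_subset_iff.2 ?_) (hω r hr Set.univ Filter.univ_mem)
    rintro _ ⟨u, hu, rfl⟩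
    obtain ⟨n, rfl⟩ : u ∈ Set.range d := hd ▸ Or.inr hu.1
    exact le_iSup (fun n => g (X (d n) ω)) n
  · have hn : d n ∈ I := by
      have : d n ∈ insert q D := hd ▸ Set.mem_range_self n
      rcases this with h | h
      · rwa [h]
      · exact hDI h
    exact le_iSup₂ (f := fun r (_ : r ∈ I) => g (X r ω)) (d n) hn

theorem lemma6p2 {Ω : Type*} [MeasurableSpace Ω] (P : Measure Ω) [IsProbabilityMeasure P]
    (Λ : Set (ℝ≥0 × ℝ) → Ω → ℝ) (hΛ : IsLevyBasis Λ P) (hmean : HasMeanZero Λ P)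
    (c : ℝ) (hc : 0 < c) (p q : ℝ≥0 × ℝ) (hpq : ConeLE c p q) :
    (∃ X : ℝ≥0 × ℝ → Ω → ℝ, IsVersion X (fun r => Λ (backwardCone c r)) P ∧
      IsSeparableOn X (coneInterval c p q) P) ∧
    ∀ X : ℝ≥0 × ℝ → Ω → ℝ, IsVersion X (fun r => Λ (backwardCone c r)) P →
      IsSeparableOn X (coneInterval c p q) P →
      AEMeasurable (fun ω => ⨆ r ∈ coneInterval c p q, ‖X r ω‖ₑ) P ∧
      (∀ l : ℝ, 0 < l →
        ENNReal.ofReal l * P {ω | ENNReal.ofReal l ≤ ⨆ r ∈ coneInterval c p q, ‖X r ω‖ₑ} ≤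
          13 * ∫⁻ ω, ‖X q ω‖ₑ ∂P) ∧
      (∀ a : ℝ, 1 < a → HasFiniteMoment Λ P a →
        ∫⁻ ω, (⨆ r ∈ coneInterval c p q, ‖X r ω‖ₑ ^ a) ∂P ≤
          ENNReal.ofReal ((a / (a - 1)) ^ (2 * a)) * ∫⁻ ω, ‖X q ω‖ₑ ^ a ∂P) := by
  refine ⟨hΛ.exists_isSeparableOn hmean hc hpq, ?_⟩
  rintro X hX ⟨D, hDc, hDI, hsep⟩
  have hq := coneInterval_right_mem hpq
  obtain ⟨d, hd⟩ := exists_seq_range_eq_insert hDc q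
  have hdI (n : ℕ) : d n ∈ coneInterval c p q := by
    have : d n ∈ insert q D := hd ▸ Set.mem_range_self n
    rcases this with h | h
    · rwa [h]
    · exact hDI h
  have hdX : ∀ᵐ ω ∂P, ∀ n, X (d n) ω = Λ (backwardCone c (d n)) ω :=
    ae_all_iff.2 fun n => hX (d n)
  have hsup (g : ℝ → ℝ≥0∞) (hg : Continuous g) :
      (fun ω => ⨆ r ∈ coneInterval c p q, g (X r ω)) =ᵐ[P]
        fun ω => ⨆ n, g (Λ (backwardCone c (d n)) ω) := by
    filter_upwards [ae_biSup_eq_iSup_of_separable hDI hsep hq hd hg, hdX] with ω h1 h2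
    simp only [h1, h2]
  have hint (g : ℝ → ℝ≥0∞) : ∫⁻ ω, g (X q ω) ∂P = ∫⁻ ω, g (Λ (backwardCone c q) ω) ∂P := by
    refine lintegral_congr_ae ?_
    filter_upwards [hX q] with ω hω
    rw [hω]
  refine ⟨?_, fun l hl => ?_, fun a ha hmom => ?_⟩
  · refine AEMeasurable.congr (Measurable.aemeasurable ?_) (hsup _ continuous_enorm).symm
    exact Measurable.iSup fun n => (hΛ.measurable _ (measurableSet_backwardCone hc _)
      (isBounded_backwardCone hc _)).enorm
  · rw [hint fun x => ‖x‖ₑ]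
    have e : P {ω | ENNReal.ofReal l ≤ ⨆ r ∈ coneInterval c p q, ‖X r ω‖ₑ} =
        P {ω | ENNReal.ofReal l ≤ ⨆ n, ‖Λ (backwardCone c (d n)) ω‖ₑ} := by
      refine measure_congr ?_
      filter_upwards [hsup _ continuous_enorm] with ω hω
      exact congrArg (ENNReal.ofReal l ≤ ·) hω
    rw [e]
    -- The bound is obtained with 6 and then weakened to 13.
    refine (hΛ.mul_measure_iSup_le hmean hc d (fun n => (hdI n).2) hl).trans ?_
    gcongr
    norm_num
  · have hg : Continuous fun x : ℝ => ‖x‖ₑ ^ a :=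
      (ENNReal.continuous_rpow_const (y := a)).comp continuous_enorm
    rw [hint fun x => ‖x‖ₑ ^ a, lintegral_congr_ae (hsup _ hg)]
    exact hΛ.lintegral_iSup_le hmean hc d (fun n => (hdI n).2) ha hmom
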